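/- **Definitions.** Let $I=\{1,2\}$ and let $\alpha_1,\alpha_2$ be the standard basis of $\mathbb Z^I$. A *Cartan scheme* (of rank two) $\mathcal C=(I,A,(\rho_i)_{i\in I},(C^a)_{a\in A})$ consists of a non-empty set $A$ of objects, maps $\rho_i:A\to A$ with $\rho_i^2=\mathrm{id}$, and generalized Cartan matrices $C^a=(c^a_{ij})\in\mathbb Z^{I\times I}$ (that is, $c^a_{ii}=2$, $c^a_{ij}\le 0$ for $i\ne j$, and $c^a_{ij}=0\Rightarrow c^a_{ji}=0$) with $c^a_{ij}=c^{\rho_i(a)}_{ij}$ for all $a,i,j$. Put $\sigma_i^a(\alpha_j)=\alpha_j-c^a_{ij}\alpha_i$. The Weyl groupoid of $\mathcal C$ has the set of objects $A$; $\mathrm{Hom}(a,b)\subseteq\mathrm{Aut}(\mathbb Z^I)$ consists of the compositions, from $a$ to $b$, of maps $\sigma_i^{a'}\in\mathrm{Hom}(a',\rho_i(a'))$; $\mathrm{End}(a)=\mathrm{Hom}(a,a)$. $\mathcal C$ is *connected* if all $\mathrm{Hom}(a,b)$ are non-empty, *simply connected* if all $\mathrm{End}(a)$ are trivial, *irreducible*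 if all $C^a$ are indecomposable. The real roots at $a$ are $R^a=\{w(\alpha_i)\mid i\in I,\ b\in A,\ w\in\mathrm{Hom}(b,a)\}$. They form a *finite root system of type $\mathcal C$* if all $R^a$ are finite and, for all $a\in A$ and $i\ne j$ in $I$: $R^a=R^a_+\cup -R^a_+$ with $R^a_+=R^a\cap\mathbb N_0^I$; $R^a\cap\mathbb Z\alpha_i=\{\alpha_i,-\alpha_i\}$; $\sigma_i^a(R^a)=R^{\rho_i(a)}$; and $(\rho_i\rho_j)^{m}(a)=a$ for $m=|R^a\cap(\mathbb N_0\alpha_i+\mathbb N_0\alpha_j)|$. A *covering* $\pi:\mathcal C\to\mathcal C'$ of connected Cartan schemes is a map $\pi:A\to A'$ with $C'^{\pi(b)}=C^b$ and $\pi(\rho_i(b))=\rho'_i(\pi(b))$ for all $b\in A$, $i\in I$. Given $a\in A$, it is called *maximal* at $a$ if there is no covering $\pi_1:\mathcal C\to\mathcal C_1$ for which $\mathrm{End}(\pi_1(a))\subseteq\mathrm{Aut}(\mathbb Z^I)$ properly contains $\mathrm{End}(\pi(a))$. **Proposition.** Let $\mathcal C$ be a connected, simply connected, irreducible Cartan scheme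 of rank two whose real roots form a finite root system of type $\mathcal C$. Let $i\in I$, $\{i,j\}=I$, $a\in A$, and $n=\lfloor |A|/2\rfloor$. Put $a_0=a$, $a_1=\rho_i(a_0)$, $a_2=\rho_j(a_1)$, $a_3=\rho_i(a_2)$, …, and let $c=\Phi(i,a)=(c_1,\dots,c_n)$ with $c_1=-c^{a_0}_{ij}$, $c_2=-c^{a_1}_{ji}$, $c_3=-c^{a_2}_{ij}$, …. Write $c=d^r$ (the sequence $d$ repeated $r$ times) with $r$ maximal, and let $m$ be the length of $d$. Then $|A|=2n>0$, $m=n/r$, $r\in\{1,2,3\}$, and $x\mapsto a_x$ is a bijection from $\{0,\dots,2n-1\}=\mathbb Z/2n$ to $A$. Let the dihedral group $\mathbb D_{2n}$ with $4n$ elements act on $\mathbb Z/2n$, and so on $A$, with generators $\mu(x)=x+1$ and $\tau(x)=-x$, and let $H=\{\mu^{2k},\tau\mu^{2k+1}\mid k\in\mathbb Z\}\le\mathbb D_{2n}$. There is a covering $\pi:\mathcal C\to\mathcal C'$ that is maximal at $a$. For every such covering there is a subgroup $S\le H$ and an isomorphism $S\to\mathrm{End}(\pi(a))$ which maps each $g\in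 S$ to an element of $\mathrm{Hom}(g(a),a)$ in the Weyl groupoid of $\mathcal C$, where $\pi(g(a))=\pi(a)$. Call $c$ of type 1 if $(c_k,\dots,c_n,c_1,\dots,c_{k-1})=(c_k,c_{k-1},\dots,c_1,c_n,\dots,c_{k+1})$ for some $k$, and of type 2 otherwise. Then $S$ is, up to isomorphism where no generator is given, | | | $r=1$ | $r=2$ | $r=3$ | |---|---|---|---|---| | $m$ even | type 1 | $Z_2\times Z_2$ | $\mathbb D_4$ | $\mathbb D_6$ | | $m$ even | type 2 | $Z_2=\langle\mu^n\rangle$ | $Z_4=\langle\mu^{n/2}\rangle$ | $Z_6=\langle\mu^{n/3}\rangle$ | | $m$ odd | type 1 | $Z_2$ | $Z_2\times Z_2$ | $Z_3\rtimes Z_2$ | | $m$ odd | type 2 | $1$ | $Z_2=\langle\mu^n\rangle$ | $Z_3=\langle\mu^{2n/3}\rangle$ | Here $Z_k$ is the cyclic group with $k$ elements, $\mathbb D_k$ the dihedral group with $2k$ elements, and $Z_2$ acts on $Z_3$ by inversion. -/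

import Mathlib

universe u

/-- A Cartan scheme with index set `I` and set of objects `A`: object changes `ρ i` and a family
of generalized Cartan matrices `cartan a`, subject to (C1) and (C2). -/
structure CartanScheme (I : Type) (A : Type u) where
  nonempty : Nonempty A
  ρ : I → A → A
  cartan : A → Matrix I I ℤ
  diag : ∀ a i, cartan a i i = 2
  off_diag : ∀ a i j, i ≠ j → cartan a i j ≤ 0
  zero_symm : ∀ a i j, cartan a i j = 0 → cartan a j i = 0
  ρ_invol : ∀ i a, ρ i (ρ i a) = a
  cartan_ρ : ∀ a i j, cartan a i j = cartan (ρ i a) i j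

namespace CartanScheme

variable {I : Type} [Fintype I] [DecidableEq I] {A : Type u}

/-- The automorphism group of `ℤ^I`. -/
abbrev Aut (I : Type) := (I → ℤ) ≃ₗ[ℤ] (I → ℤ)

/-- The standard basis vector `α_i` of `ℤ^I`. -/
def simpleRoot (i : I) : I → ℤ := Pi.single i 1

/-- The linear form `α_j ↦ c^a_{ij}`. -/
def coroot (C : CartanScheme I A) (i : I) (a : A) : Module.Dual ℤ (I → ℤ) :=
  LinearMap.proj i ∘ₗ (C.cartan a).mulVecLin

theorem coroot_simpleRoot (C : CartanScheme I A) (i j : I) (a : A) :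
    C.coroot i a (simpleRoot j) = C.cartan a i j := by
  simp [coroot, simpleRoot]

/-- The reflection `σ_i^a`, `α_j ↦ α_j - c^a_{ij} α_i`. -/
def reflection (C : CartanScheme I A) (i : I) (a : A) : Aut I :=
  Module.reflection (x := simpleRoot i) (f := C.coroot i a)
    ((C.coroot_simpleRoot i i a).trans (C.diag a i))

theorem reflection_simpleRoot (C : CartanScheme I A) (i j : I) (a : A) :
    C.reflection i a (simpleRoot j) = simpleRoot j - C.cartan a i j • simpleRoot i := by
  simp [reflection, Module.reflection_apply, coroot_simpleRoot]

theorem coroot_ρ (C : CartanScheme I A) (i : I) (a : A) :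
    C.coroot i (C.ρ i a) = C.coroot i a := by
  ext j
  simp [coroot, ← C.cartan_ρ]

theorem reflection_ρ (C : CartanScheme I A) (i : I) (a : A) :
    C.reflection i (C.ρ i a) = C.reflection i a := by
  apply LinearEquiv.ext
  intro v
  simp [reflection, Module.reflection_apply, coroot_ρ]

theorem reflection_mul_self (C : CartanScheme I A) (i : I) (a : A) :
    C.reflection i a * C.reflection i a = 1 := by
  apply LinearEquiv.ext
  intro v
  exact Module.involutive_reflection _ v

/-- `C.Mor a b w` says that `w` is a morphism from `a` to `b` in the Weyl groupoid of `C`, the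
category generated by the maps `σ_i^b : b → ρ_i(b)`. -/
inductive Mor (C : CartanScheme I A) : A → A → Aut I → Prop
  | id (a : A) : Mor C a a 1
  | step {a b : A} {w : Aut I} (i : I) :
      Mor C a b w → Mor C a (C.ρ i b) (C.reflection i b * w)

/-- `Hom(a,b)` in the Weyl groupoid, as a set of automorphisms of `ℤ^I`. -/
def Hom (C : CartanScheme I A) (a b : A) : Set (Aut I) := {w | C.Mor a b w}

theorem Mor.comp {C : CartanScheme I A} {a b c : A} {v w : Aut I}
    (hw : C.Mor a b w) (hv : C.Mor b c v) : C.Mor a c (v * w) := by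
  induction hv with
  | id => simpa using hw
  | step i _ ih => rw [mul_assoc]; exact .step i ih

theorem Mor.inv {C : CartanScheme I A} {a b : A} {w : Aut I}
    (hw : C.Mor a b w) : C.Mor b a w⁻¹ := by
  induction hw with
  | id => simpa using Mor.id _
  | @step b w i _ ih =>
    have h1 : C.Mor (C.ρ i b) b (C.reflection i b) := by
      have h := Mor.step (C := C) i (Mor.id (C.ρ i b))
      rwa [C.ρ_invol, mul_one, reflection_ρ] at h
    have h2 : (C.reflection i b)⁻¹ = C.reflection i b :=
      inv_eq_of_mul_eq_one_left (C.reflection_mul_self i b)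
    rw [mul_inv_rev, h2]
    exact h1.comp ih

/-- The group `End(a) = Hom(a,a)`. -/
def End (C : CartanScheme I A) (a : A) : Subgroup (Aut I) where
  carrier := C.Hom a a
  mul_mem' hv hw := Mor.comp hw hv
  one_mem' := Mor.id a
  inv_mem' hw := Mor.inv hw

/-- The Weyl groupoid of `C` is connected. -/
def Connected (C : CartanScheme I A) : Prop := ∀ a b, (C.Hom a b).Nonempty

/-- All groups `End(a)` are trivial. -/
def SimplyConnected (C : CartanScheme I A) : Prop := ∀ a, C.End a = ⊥

/-- All Cartan matrices `C^a` are indecomposable. -/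
def Irreducible (C : CartanScheme I A) : Prop :=
  ∀ a, ∀ J : Set I, J.Nonempty → Jᶜ.Nonempty → ∃ i ∈ J, ∃ j ∈ Jᶜ, C.cartan a i j ≠ 0

/-- The real roots `w(α_i)` at `a`, with `w ∈ Hom(b,a)`. -/
def realRoots (C : CartanScheme I A) (a : A) : Set (I → ℤ) :=
  {β | ∃ b, ∃ w ∈ C.Hom b a, ∃ i, β = w (simpleRoot i)}

/-- `R` is a root system of type `C`. -/
structure IsRootSystem (C : CartanScheme I A) (R : A → Set (I → ℤ)) : Prop where
  pos_neg : ∀ a, R a = {β | β ∈ R a ∧ 0 ≤ β} ∪ {β | -β ∈ R a ∧ 0 ≤ -β}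
  multiples : ∀ a i, R a ∩ {β | ∃ k : ℤ, β = k • simpleRoot i} = {simpleRoot i, -simpleRoot i}
  reflect : ∀ a i, C.reflection i a '' R a = R (C.ρ i a)
  coxeter : ∀ a i j, i ≠ j →
    ∀ P : Set (I → ℤ),
      P = R a ∩ {β | ∃ k l : ℕ, β = k • simpleRoot i + l • simpleRoot j} →
      P.Finite → (C.ρ i ∘ C.ρ j)^[P.ncard] a = a

/-- `R` is a finite root system of type `C`. -/
def IsFiniteRootSystem (C : CartanScheme I A) (R : A → Set (I → ℤ)) : Prop :=
  C.IsRootSystem R ∧ ∀ a, (R a).Finite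

/-- `π : C → C'` is a covering of connected Cartan schemes. -/
structure IsCovering {A' : Type u} (C : CartanScheme I A) (C' : CartanScheme I A')
    (π : A → A') : Prop where
  connected : C.Connected
  connected' : C'.Connected
  cartan_eq : ∀ a, C'.cartan (π a) = C.cartan a
  comm : ∀ i a, π (C.ρ i a) = C'.ρ i (π a)

/-- `π : C → C'` is a covering for which `End(π(a))`, as a group of automorphisms of `ℤ^I`, is
maximal with respect to inclusion, among all coverings starting at `C`. -/
def IsMaximalCovering {A' : Type u} (C : CartanScheme I A) (C' : CartanScheme I A')
    (π : A → A') (a : A) : Prop :=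
  C.IsCovering C' π ∧
    ∀ (A₁ : Type u) (C₁ : CartanScheme I A₁) (π₁ : A → A₁), C.IsCovering C₁ π₁ →
      C'.End (π a) ≤ C₁.End (π₁ a) → C₁.End (π₁ a) = C'.End (π a)

/-! ### Rank two -/

/-- The labels `i, j, i, j, …` with `{i, j} = {0, 1}`. -/
def label (i : Fin 2) (k : ℕ) : Fin 2 := if Even k then i else i + 1

/-- The objects `a, ρ_i(a), ρ_j(ρ_i(a)), …` (numbered from `0`) along the object change diagram. -/
def walk (C : CartanScheme (Fin 2) A) (i : Fin 2) (a : A) : ℕ → A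
  | 0 => a
  | k + 1 => C.ρ (label i k) (walk C i a k)

/-- The sequence `Φ(i,a) = (c_1, …, c_n)` of negated Cartan entries along the walk; here `n`
is to be half the number of objects. -/
def Phi (C : CartanScheme (Fin 2) A) (n : ℕ) (i : Fin 2) (a : A) : List ℤ :=
  (List.range n).map fun k => -C.cartan (C.walk i a k) (label i k) (label i (k + 1))

end CartanScheme

/-- The repeated sequence `d^r`. -/
def seqPow (d : List ℤ) (r : ℕ) : List ℤ := (List.replicate r d).flatten

/-- `c = (a_1, …, a_n)` is of type 1: for some `k`,
`(a_k, …, a_n, a_1, …, a_{k-1}) = (a_k, a_{k-1}, …, a_1, a_n, …, a_{k+1})`. -/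
def IsTypeOne (c : List ℤ) : Prop :=
  ∃ k < c.length, c.rotate k = (c.rotate (k + 1)).reverse

/-- The rotation `μ` of the cycle with `2n` vertices by one step. -/
def dihedralμ (n : ℕ) : DihedralGroup (2 * n) := DihedralGroup.r 1

/-- The reflection `τ` of the cycle with `2n` vertices fixing the vertex `0`. -/
def dihedralτ (n : ℕ) : DihedralGroup (2 * n) := DihedralGroup.sr 0

/-- The action of the dihedral group on the vertices of the cycle with `2n` vertices:
`μ(x) = x + 1` and `τ(x) = -x`. -/
instance dihedralAction (n : ℕ) : MulAction (DihedralGroup (2 * n)) (ZMod (2 * n)) where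
  smul g x := match g with
    | .r k => x + k
    | .sr k => -(x + k)
  one_smul x := by
    change x + 0 = x
    simp
  mul_smul g h x := by
    rcases g with k | k <;> rcases h with l | l
    · change x + (k + l) = (x + l) + k; ring
    · change -(x + (l - k)) = -(x + l) + k; ring
    · change -(x + (k + l)) = -((x + l) + k); ring
    · change x + (l - k) = -(-(x + l) + k); ring

/-- The subgroup `H = {μ^{2k}, τμ^{2k+1} | k ∈ ℤ}` of the dihedral group with `4n` elements. -/
def subgroupH (n : ℕ) : Subgroup (DihedralGroup (2 * n)) where
  carrier := {g | ∃ k : ℤ, g = dihedralμ n ^ (2 * k) ∨ g = dihedralτ n * dihedralμ n ^ (2 * k + 1)}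
  mul_mem' := by
    rintro _ _ ⟨k, rfl | rfl⟩ ⟨l, rfl | rfl⟩
    · refine ⟨k + l, Or.inl ?_⟩
      simp [dihedralμ, mul_add]
    · refine ⟨l - k, Or.inr ?_⟩
      simp [dihedralμ, dihedralτ]; ring
    · refine ⟨k + l, Or.inr ?_⟩
      simp [dihedralμ, dihedralτ]; ring
    · refine ⟨l - k, Or.inl ?_⟩
      simp [dihedralμ, dihedralτ]; ring
  one_mem' := ⟨0, Or.inl (by simp)⟩
  inv_mem' := by
    rintro _ ⟨k, rfl | rfl⟩
    · exact ⟨-k, Or.inl (by simp)⟩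
    · exact ⟨k, Or.inr (by simp [dihedralμ, dihedralτ])⟩

namespace CartanScheme

variable {A : Type u}

/-- The object at the vertex `x` of the object change diagram, a cycle with `2n` vertices, which
is numbered such that `a` is at `0` and `ρ_i(a)` is at `1`. -/
def vertex (C : CartanScheme (Fin 2) A) (n : ℕ) (i : Fin 2) (a : A)
    (x : ZMod (2 * n)) : A :=
  C.walk i a x.val

/-- For a covering `π : C → C'` of a simply connected Cartan scheme, the group `End(π(a))` is given
by the subgroup `S` of the dihedral group acting on the object change diagram of `C`: an element
`g` of `S` corresponds to the morphism of `C` from `g(a)` to `a`, considered via `π` as an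
endomorphism of `π(a)`. -/
def EndGivenBy {A' : Type u} (C : CartanScheme (Fin 2) A) (C' : CartanScheme (Fin 2) A')
    (π : A → A') (n : ℕ) (i : Fin 2) (a : A) (S : Subgroup (DihedralGroup (2 * n))) : Prop :=
  ∃ e : S ≃* C'.End (π a), ∀ g : S,
    π (C.vertex n i a (g.1 • 0)) = π a ∧
      (e g : Aut (Fin 2)) ∈ C.Hom (C.vertex n i a (g.1 • 0)) a

end CartanScheme

/-- The cyclic group with `k` elements. -/
abbrev Cyc (k : ℕ) := Multiplicative (ZMod k)

/-! Walk alternately along `ρ i` and `ρ (i + 1)`, and write a root in coordinates with respect to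
the two simple roots, the one about to be reflected first. Every reflection then becomes (x, y) ↦
(y, e k * y - x), so the groupoid is governed by a second-order recursion of determinant 1. Since
roots have no mixed signs, the solution starting with 0, 1 stays positive until some step N, at
which all coordinates are negated. Every positive root occurs within N steps, so there are at most N
of them. Conversely, the Coxeter condition closes the walk after twice the number of positive roots,
and simple connectedness makes that loop the identity, which cannot happen before step 2N. Hence A
is a cycle of length 2N and the entries have period N = n.

The group H acts simply transitively on A and commutes with the object changes. If a covering π
identifies g(a) with a, it identifies g(b) with b for all b, so g preserves all Cartan matrices. The
quotient of C by the subgroup S of all such g therefore has the largest endomorphism group at a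
among all coverings, and a maximal covering has this same group, isomorphic to S.

The two off-diagonal Cartan entries at a vertex belong to its two edges, so S consists of the
symmetries in H of the n-periodic edge sequence. Its rotations are the μ^k with k divisible by 2 and
by m, and it contains reflections exactly for type 1; this gives the table. Finally r ≤ 3 is a trace
argument: for r ≥ 4 the monodromy over one block d has trace at least 2, and the solution could not
return to 0. -/

/-- The solution `x` of the recursion `x (k + 2) = e k * x (k + 1) - x k` with given initial
values. -/
def contSeq (e : ℕ → ℤ) (x₀ x₁ : ℤ) : ℕ → ℤ
  | 0 => x₀
  | 1 => x₁
  | k + 2 => e k * contSeq e x₀ x₁ (k + 1) - contSeq e x₀ x₁ k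

/-! ### The second-order recursion of determinant 1 -/

namespace contSeq

variable {e : ℕ → ℤ}

theorem zero (x₀ x₁ : ℤ) : contSeq e x₀ x₁ 0 = x₀ := rfl

theorem one (x₀ x₁ : ℤ) : contSeq e x₀ x₁ 1 = x₁ := rfl

theorem add_two (x₀ x₁ : ℤ) (k : ℕ) :
    contSeq e x₀ x₁ (k + 2) = e k * contSeq e x₀ x₁ (k + 1) - contSeq e x₀ x₁ k := rfl

theorem eq_of_rec {y : ℕ → ℤ} (hy : ∀ k, y (k + 2) = e k * y (k + 1) - y k) (k : ℕ) :
    y k = contSeq e (y 0) (y 1) k ∧ y (k + 1) = contSeq e (y 0) (y 1) (k + 1) := by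
  induction k with
  | zero => exact ⟨rfl, rfl⟩
  | succ k ih => exact ⟨ih.2, by rw [hy, add_two, ih.1, ih.2]⟩

theorem linear (x₀ x₁ : ℤ) (k : ℕ) :
    contSeq e x₀ x₁ k = x₀ * contSeq e 1 0 k + x₁ * contSeq e 0 1 k := by
  have h := (eq_of_rec (e := e) (y := fun k => x₀ * contSeq e 1 0 k + x₁ * contSeq e 0 1 k)
    (fun k => by simp only [add_two]; ring) k).1
  simpa [zero, one] using h.symm

theorem det (k : ℕ) : contSeq e 1 0 k * contSeq e 0 1 (k + 1) -
    contSeq e 1 0 (k + 1) * contSeq e 0 1 k = 1 := by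
  induction k with
  | zero => simp [zero, one]
  | succ k ih => rw [add_two, add_two]; linear_combination ih

theorem shift {m : ℕ} (hm : ∀ k, e (k + m) = e k) (x₀ x₁ : ℤ) (k : ℕ) :
    contSeq e x₀ x₁ (k + m) = contSeq e (contSeq e x₀ x₁ m) (contSeq e x₀ x₁ (m + 1)) k := by
  have h := (eq_of_rec (e := e) (y := fun k => contSeq e x₀ x₁ (k + m))
    (fun k => by
      have := add_two (e := e) x₀ x₁ (k + m)
      rw [hm] at this
      convert this using 2 <;> ring_nf) k).1
  simpa [add_comm 1 m] using h

/-- At an interior zero the two neighbours are opposite and nonnegative, so both vanish,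
contradicting determinant 1. -/
theorem pos_of_nonneg {N : ℕ} (hN : ∀ k ≤ N, 0 ≤ contSeq e 0 1 k)
    {k : ℕ} (h0 : 0 < k) (hk : k < N) : 0 < contSeq e 0 1 k := by
  refine lt_of_le_of_ne (hN k hk.le) fun h1 => ?_
  obtain ⟨l, rfl⟩ := Nat.exists_eq_succ_of_ne_zero h0.ne'
  have h2 := contSeq.add_two (e := e) 0 1 l
  have h3 := hN l (by omega)
  have h4 := hN (l + 2) hk
  have h5 := contSeq.det (e := e) (l + 1)
  simp only [Nat.succ_eq_add_one] at h1
  rw [← h1] at h2 h5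
  have h6 : contSeq e 0 1 (l + 1 + 1) = 0 := by
    change contSeq e 0 1 (l + 2) = 0
    linarith
  simp [h6] at h5

end contSeq

/-! ### Roots along a walk, and the half-period N -/

/-- The positions of the roots along a walk in the object change diagram of a rank two Cartan
scheme, in coordinates with respect to the pairs of simple roots. -/
structure RootSequence (e : ℕ → ℤ) (R : ℕ → Set (ℤ × ℤ)) : Prop where
  fst_mem : ∀ k, (1, 0) ∈ R k
  snd_mem : ∀ k, (0, 1) ∈ R k
  sign : ∀ k x y, (x, y) ∈ R k → (0 ≤ x ∧ 0 ≤ y) ∨ (x ≤ 0 ∧ y ≤ 0)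
  neg_mem : ∀ k x y, (x, y) ∈ R k → (-x, -y) ∈ R k
  fst_mul : ∀ k x, (x, 0) ∈ R k → x = 1 ∨ x = -1
  snd_mul : ∀ k y, (0, y) ∈ R k → y = 1 ∨ y = -1
  step : ∀ k x y, (x, y) ∈ R k ↔ (y, e k * y - x) ∈ R (k + 1)

namespace RootSequence

variable {e : ℕ → ℤ} {R : ℕ → Set (ℤ × ℤ)}

theorem mem_iff (h : RootSequence e R) (x y : ℤ) (k : ℕ) :
    (x, y) ∈ R 0 ↔ (contSeq e x y k, contSeq e x y (k + 1)) ∈ R k := by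
  induction k with
  | zero => rfl
  | succ k ih => rw [ih, h.step]; rfl

theorem entry_mem (h : RootSequence e R) {k : ℕ} : (e k, 1) ∈ R k := by
  rw [h.step]; simpa using h.fst_mem (k + 1)

/-- The image of (t, 1) is (1, e k - t), which cannot have mixed signs. So e k is the largest such t
and is determined by the set R k alone. -/
theorem le_of_mem (h : RootSequence e R) {k : ℕ} {t : ℤ} (ht : (t, 1) ∈ R k) : t ≤ e k := by
  rw [h.step] at ht
  rcases h.sign _ _ _ ht with ⟨-, h1⟩ | ⟨h1, -⟩ <;> linarith

theorem eq_of_eq (h : RootSequence e R) {k l : ℕ} (hR : R k = R l) : e k = e l :=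
  le_antisymm (h.le_of_mem (hR ▸ h.entry_mem)) (h.le_of_mem (hR ▸ h.entry_mem))

theorem succ_eq_succ (h : RootSequence e R) {k l : ℕ} (hR : R k = R l) :
    R (k + 1) = R (l + 1) := by
  ext ⟨x, y⟩
  have h1 := h.step k (e k * x - y) x
  have h2 := h.step l (e l * x - y) x
  rw [sub_sub_cancel] at h1 h2
  rw [← h1, ← h2, hR, h.eq_of_eq hR]

theorem add_eq (h : RootSequence e R) {N : ℕ} (hR : R N = R 0) (k : ℕ) : R (k + N) = R k := by
  induction k with
  | zero => simpa using hR
  | succ k ih => rw [add_right_comm]; exact h.succ_eq_succ ih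

/-- After finitely many steps, say `N`, the coordinates of a root are negated. -/
theorem exists_antiperiod (h : RootSequence e R) {P : ℕ} (hP : 0 < P)
    (hP0 : contSeq e 0 1 P = 0) :
    ∃ N, 0 < N ∧ (∀ k, 0 < k → k < N → 0 < contSeq e 0 1 k) ∧
      ∀ x y, contSeq e x y N = -x ∧ contSeq e x y (N + 1) = -y := by
  -- Without negative values, the solution would be strictly positive at `P`.
  have hex : ∃ k, contSeq e 0 1 (k + 1) < 0 := by
    by_contra! hne
    have := contSeq.pos_of_nonneg (N := P + 1) (fun k _ => by
      cases k with
      | zero => exact le_rfl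
      | succ k => exact hne k) hP (Nat.lt_succ_self P)
    omega
  classical
  obtain ⟨N, hN, hmin⟩ : ∃ N, contSeq e 0 1 (N + 1) < 0 ∧
      ∀ k < N, 0 ≤ contSeq e 0 1 (k + 1) :=
    ⟨Nat.find hex, Nat.find_spec hex, fun k hk => not_lt.1 (Nat.find_min hex hk)⟩
  have hnn : ∀ k ≤ N, 0 ≤ contSeq e 0 1 k := fun k hk => by
    cases k with
    | zero => exact le_rfl
    | succ k => exact hmin k hk
  have hN0 : 0 < N := by
    rcases Nat.eq_zero_or_pos N with rfl | h0
    · exact absurd hN (by simp [contSeq.one])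
    · exact h0
  refine ⟨N, hN0, fun k h0 hk => contSeq.pos_of_nonneg hnn h0 hk, ?_⟩
  have hdet := contSeq.det (e := e) N
  -- The values at N and N + 1 are the coordinates of a root, the first nonnegative and the second
  -- negative.
  have hu : contSeq e 0 1 N = 0 := by
    rcases h.sign _ _ _ ((h.mem_iff 0 1 N).1 (h.snd_mem 0)) with h1 | h1 <;>
      linarith [hnn N le_rfl]
  rw [hu, mul_zero, sub_zero] at hdet
  have hu1 : contSeq e 0 1 (N + 1) = -1 := by
    rcases Int.isUnit_iff.1 (IsUnit.of_mul_eq_one_right _ hdet) with h1 | h1 <;> linarith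
  have hz : contSeq e 1 0 N = -1 := by rw [hu1] at hdet; linarith
  -- With z this value, (-1, z) is the image of (1, 0), so z ≤ 0; the preimage of (1, 0) is (-1,
  -- -z), so z ≥ 0.
  have hz1 : contSeq e 1 0 (N + 1) = 0 := by
    have h1 := h.sign _ _ _ ((h.mem_iff 1 0 N).1 (h.fst_mem 0))
    have h2 : (-1, -contSeq e 1 0 (N + 1)) ∈ R 0 := by
      rw [h.mem_iff _ _ N, contSeq.linear (-1), contSeq.linear (-1) _ (N + 1), hu, hu1, hz]
      simpa using h.fst_mem N
    have h3 := h.sign _ _ _ h2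
    omega
  intro x y
  rw [contSeq.linear, contSeq.linear _ _ (N + 1), hu, hu1, hz, hz1]
  constructor <;> ring

section Antiperiod

variable {N : ℕ} (hneg : ∀ x y, contSeq e x y N = -x ∧ contSeq e x y (N + 1) = -y)

include hneg

theorem R_antiperiod (h : RootSequence e R) : R N = R 0 := by
  ext ⟨x, y⟩
  have h1 := h.mem_iff (-x) (-y) N
  rw [(hneg _ _).1, (hneg _ _).2, neg_neg, neg_neg] at h1
  rw [← h1]
  exact ⟨fun h2 => by simpa using h.neg_mem _ _ _ h2, fun h2 => h.neg_mem _ _ _ h2⟩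

theorem periodic (h : RootSequence e R) (k : ℕ) : e (k + N) = e k :=
  h.eq_of_eq (h.add_eq (h.R_antiperiod hneg) k)

theorem contSeq_add (h : RootSequence e R) (x y : ℤ) (k : ℕ) :
    contSeq e x y (k + N) = -contSeq e x y k := by
  rw [contSeq.shift (h.periodic hneg), (hneg x y).1, (hneg x y).2, contSeq.linear,
    contSeq.linear x y]
  ring

/-- The solution is positive strictly between 0 and N, is followed by -1 at N, and is negative
strictly between N and 2N. So the initial state 0, 1 cannot recur before 2N. -/
theorem dvd_of_eq_one (h : RootSequence e R)
    (hpos : ∀ k, 0 < k → k < N → 0 < contSeq e 0 1 k) {k : ℕ} (hk0 : 0 < k)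
    (h0 : contSeq e 0 1 k = 0) (h1 : contSeq e 0 1 (k + 1) = 1) : 2 * N ≤ k := by
  by_contra! hk
  rcases lt_trichotomy k N with h2 | rfl | h2
  · exact (hpos k hk0 h2).ne' h0
  · rw [(hneg 0 1).2] at h1; omega
  · obtain ⟨l, rfl⟩ := Nat.exists_eq_add_of_lt h2
    have h3 := h.contSeq_add hneg 0 1 (l + 1)
    have h4 := hpos (l + 1) (by omega) (by omega)
    rw [show l + 1 + N = N + l + 1 by ring, h0] at h3
    omega

/-- Follow a positive root until its coordinate first drops to 0 or below. The sign condition makes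
this value 0, and then the previous one is 1, since the only multiples of a simple root are its
negative and itself. Inverting the determinant 1 transition recovers the root from the step k. -/
theorem pos_roots_subset (h : RootSequence e R) (hN : 0 < N) :
    {v : ℤ × ℤ | v ∈ R 0 ∧ 0 ≤ v.1 ∧ 0 ≤ v.2} ⊆
      (fun k => (contSeq e 0 1 (k + 1), -contSeq e 1 0 (k + 1))) '' (Finset.range N : Set ℕ) := by
  classical
  rintro ⟨x, y⟩ ⟨hv, hx, hy⟩
  simp only at hx hy
  suffices H : ∃ k < N, contSeq e x y k = 1 ∧ contSeq e x y (k + 1) = 0 by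
    obtain ⟨k, hk, h1, h2⟩ := H
    refine ⟨k, by simpa using hk, ?_⟩
    have hd := contSeq.det (e := e) k
    rw [contSeq.linear] at h1 h2
    ext
    · change contSeq e 0 1 (k + 1) = x
      linear_combination (-contSeq e 0 1 (k + 1)) * h1 + contSeq e 0 1 k * h2 + x * hd
    · change -contSeq e 1 0 (k + 1) = y
      linear_combination contSeq e 1 0 (k + 1) * h1 - contSeq e 1 0 k * h2 + y * hd
  rcases hx.eq_or_lt with rfl | hx
  · refine ⟨N - 1, by omega, ?_⟩
    have hy1 : y = 1 := by rcases h.snd_mul _ _ hv with h1 | h1 <;> omega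
    subst hy1
    have hm := (h.mem_iff 0 1 (N - 1)).1 hv
    have h0 : contSeq e 0 1 (N - 1 + 1) = 0 := by
      rw [Nat.sub_add_cancel hN, (hneg 0 1).1, neg_zero]
    refine ⟨?_, h0⟩
    have h2 := contSeq.add_two (e := e) 0 1 (N - 1)
    rw [show N - 1 + 2 = N + 1 by omega, (hneg 0 1).2, h0] at h2
    linarith
  · have hex : ∃ k, contSeq e x y k ≤ 0 := ⟨N, by rw [(hneg x y).1]; omega⟩
    obtain ⟨k, hk, hmin, hkN⟩ : ∃ k, contSeq e x y k ≤ 0 ∧ (∀ l < k, 0 < contSeq e x y l) ∧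
        k ≤ N :=
      ⟨Nat.find hex, Nat.find_spec hex, fun k hk => not_le.1 (Nat.find_min hex hk),
        Nat.find_min' hex (by rw [(hneg x y).1]; omega)⟩
    cases k with
    | zero => exact absurd hk (not_le.2 hx)
    | succ k =>
      have h1 := hmin k (Nat.lt_succ_self k)
      have hm := (h.mem_iff x y k).1 hv
      have h2 : contSeq e x y (k + 1) = 0 := by
        rcases h.sign _ _ _ hm with h3 | h3 <;> omega
      rw [h2] at hm
      refine ⟨k, by omega, ?_, h2⟩
      rcases h.fst_mul _ _ hm with h3 | h3 <;> omega

theorem ncard_pos_roots_le (h : RootSequence e R) (hN : 0 < N) :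
    {v : ℤ × ℤ | v ∈ R 0 ∧ 0 ≤ v.1 ∧ 0 ≤ v.2}.ncard ≤ N :=
  (Set.ncard_le_ncard (h.pos_roots_subset hneg hN) (Set.toFinite _)).trans
    ((Set.ncard_image_le (Set.toFinite _)).trans (by simp))

end Antiperiod

end RootSequence

/-! ### The bound r ≤ 3 -/

/-- If `e` is `m`-periodic, and the solution of the recursion with initial values `0, 1` vanishes
at `r * m` for the first time, then `r ≤ 3`. -/
theorem contSeq.le_three_of_periodic {e : ℕ → ℤ} {m r : ℕ} (hm : ∀ k, e (k + m) = e k)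
    (hpos : ∀ k, 0 < k → k < r * m → 0 < contSeq e 0 1 k) (hzero : contSeq e 0 1 (r * m) = 0)
    (hm0 : 0 < m) : r ≤ 3 := by
  by_contra! hr
  set U : ℕ → ℤ := fun k => contSeq e 0 1 (k * m) with hU
  -- The trace of the transition matrix over one period; by Cayley–Hamilton and determinant 1 the
  -- samples `U` satisfy `hrec`.
  set t : ℤ := contSeq e 1 0 m + contSeq e 0 1 (m + 1) with ht
  have hrec : ∀ k, U (k + 2) = t * U (k + 1) - U k := fun k => by
    have hs : ∀ j, contSeq e 0 1 (j * m + m) = contSeq e 0 1 (j * m) * contSeq e 1 0 m +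
        contSeq e 0 1 (j * m + 1) * contSeq e 0 1 m ∧ contSeq e 0 1 (j * m + m + 1) =
        contSeq e 0 1 (j * m) * contSeq e 1 0 (m + 1) +
        contSeq e 0 1 (j * m + 1) * contSeq e 0 1 (m + 1) := fun j => by
      have hp : ∀ k, e (k + j * m) = e k := fun k => by
        induction j with
        | zero => simp
        | succ j ih => rw [add_mul, one_mul, ← add_assoc, hm, ih]
      rw [← contSeq.linear, ← contSeq.linear, add_comm (j * m) m, contSeq.shift hp,
        add_right_comm, contSeq.shift hp]
      exact ⟨rfl, rfl⟩
    have h1 := hs k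
    have h2 := hs (k + 1)
    have hd := contSeq.det (e := e) m
    simp only [hU, ht]
    rw [show (k + 2) * m = (k + 1) * m + m by ring, h2.1, show (k + 1) * m = k * m + m by ring,
      h1.2, h1.1]
    linear_combination (-contSeq e 0 1 (k * m)) * hd
  have hU0 : U 0 = 0 := by simp [hU, contSeq.zero]
  have hUpos : ∀ k, 0 < k → k < r → 0 < U k := fun k h0 hk =>
    hpos _ (Nat.mul_pos h0 hm0) (Nat.mul_lt_mul_of_pos_right hk hm0)
  have h1 := hUpos 1 (by omega) (by omega)
  have h2 := hUpos 2 (by omega) (by omega)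
  have h3 := hUpos 3 (by omega) (by omega)
  have e2 := hrec 0
  have e3 := hrec 1
  simp only [zero_add, hU0, sub_zero, Nat.reduceAdd] at e2 e3
  have ht1 : 0 < t := by
    by_contra! h
    nlinarith
  -- For t = 1 the recursion gives U 3 = 0, but 3 < r. From t ≥ 2 on, `U` is nondecreasing and
  -- cannot vanish at r.
  have ht2 : 2 ≤ t := by
    by_contra! h
    have : t = 1 := by omega
    rw [this] at e2 e3
    omega
  have hmono : ∀ k, k + 1 ≤ r → U k ≤ U (k + 1) := fun k => by
    induction k with
    | zero => intro _; rw [hU0]; exact h1.le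
    | succ k ih =>
      intro hk
      have h4 := ih (by omega)
      have h5 := hUpos (k + 1) (by omega) (by omega)
      have h6 := hrec k
      rw [show k + 1 + 1 = k + 2 by rfl]
      nlinarith
  have h4 := hmono (r - 1) (by omega)
  rw [Nat.sub_add_cancel (by omega)] at h4
  have h5 := hUpos (r - 1) (by omega) (by omega)
  have h6 : U r = 0 := hzero
  omega

/-! ### Walks in a rank two Cartan scheme -/

theorem Fin.two_add_one_add_one (l : Fin 2) : l + 1 + 1 = l := by fin_cases l <;> rfl

theorem Fin.two_add_one_ne (l : Fin 2) : l + 1 ≠ l := by fin_cases l <;> decide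

theorem Fin.two_eq_or (l k : Fin 2) : k = l ∨ k = l + 1 := by
  fin_cases l <;> fin_cases k <;> decide

namespace CartanScheme

variable {A : Type u}

/-- The vector with coordinates `x, y` with respect to `α_l, α_{l + 1}`. -/
def frame (l : Fin 2) (x y : ℤ) : Fin 2 → ℤ := x • simpleRoot l + y • simpleRoot (l + 1)

theorem frame_apply_self (l : Fin 2) (x y : ℤ) : frame l x y l = x := by
  simp [frame, simpleRoot, (Fin.two_add_one_ne l).symm]

theorem frame_apply_succ (l : Fin 2) (x y : ℤ) : frame l x y (l + 1) = y := by
  simp [frame, simpleRoot, Fin.two_add_one_ne l]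

theorem frame_inj {l : Fin 2} {x y x' y' : ℤ} :
    frame l x y = frame l x' y' ↔ x = x' ∧ y = y' := by
  refine ⟨fun h => ⟨?_, ?_⟩, by rintro ⟨rfl, rfl⟩; rfl⟩
  · simpa [frame_apply_self] using congrFun h l
  · simpa [frame_apply_succ] using congrFun h (l + 1)

theorem frame_swap (l : Fin 2) (x y : ℤ) : frame (l + 1) x y = frame l y x := by
  rw [frame, frame, Fin.two_add_one_add_one, add_comm]

theorem frame_neg (l : Fin 2) (x y : ℤ) : frame l (-x) (-y) = -frame l x y := by
  simp [frame, add_comm]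

theorem frame_one_zero (l : Fin 2) : frame l 1 0 = simpleRoot l := by simp [frame]

theorem frame_zero_one (l : Fin 2) : frame l 0 1 = simpleRoot (l + 1) := by simp [frame]

theorem frame_nonneg (l : Fin 2) (x y : ℤ) : 0 ≤ frame l x y ↔ 0 ≤ x ∧ 0 ≤ y := by
  constructor
  · intro h
    exact ⟨by simpa [frame_apply_self] using h l, by simpa [frame_apply_succ] using h (l + 1)⟩
  · rintro ⟨hx, hy⟩ k
    rcases Fin.two_eq_or l k with rfl | rfl
    · rw [frame_apply_self]; exact hx
    · rw [frame_apply_succ]; exact hy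

theorem label_succ (i : Fin 2) (k : ℕ) : label i (k + 1) = label i k + 1 := by
  unfold label
  by_cases h : Even k <;> simp [h, Nat.even_add_one, Fin.two_add_one_add_one]

theorem label_of_even (i : Fin 2) {k : ℕ} (hk : Even k) : label i k = i := if_pos hk

variable (C : CartanScheme (Fin 2) A)

theorem reflection_frame (l : Fin 2) (b : A) (x y : ℤ) :
    C.reflection l b (frame l x y) = frame (l + 1) y (-C.cartan b l (l + 1) * y - x) := by
  rw [frame_swap, frame, frame, map_add, map_smul, map_smul, reflection_simpleRoot,
    reflection_simpleRoot, C.diag]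
  module

/-- The negated Cartan entries along the walk. -/
def entry (i : Fin 2) (a : A) (k : ℕ) : ℤ :=
  -C.cartan (C.walk i a k) (label i k) (label i (k + 1))

/-- The morphism from `a` to the `k`-th object of the walk. -/
def walkMap (i : Fin 2) (a : A) : ℕ → Aut (Fin 2)
  | 0 => 1
  | k + 1 => C.reflection (label i k) (C.walk i a k) * walkMap i a k

theorem mor_walkMap (i : Fin 2) (a : A) (k : ℕ) :
    C.Mor a (C.walk i a k) (C.walkMap i a k) := by
  induction k with
  | zero => exact Mor.id a
  | succ k ih => exact Mor.step _ ih

theorem walkMap_frame (i : Fin 2) (a : A) (x y : ℤ) (k : ℕ) :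
    C.walkMap i a k (frame i x y) = frame (label i k) (contSeq (C.entry i a) x y k)
      (contSeq (C.entry i a) x y (k + 1)) := by
  induction k with
  | zero => rfl
  | succ k ih =>
    rw [walkMap, LinearEquiv.mul_apply, ih, reflection_frame, label_succ, contSeq.add_two, entry,
      label_succ]

/-- The real roots along the walk, in coordinates. -/
def rootCoords (i : Fin 2) (a : A) (k : ℕ) : Set (ℤ × ℤ) :=
  {v | frame (label i k) v.1 v.2 ∈ C.realRoots (C.walk i a k)}

theorem simpleRoot_mem_realRoots (l : Fin 2) (b : A) : simpleRoot l ∈ C.realRoots b :=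
  ⟨b, 1, Mor.id b, l, rfl⟩

variable {C}

theorem IsRootSystem.neg_mem {R : A → Set (Fin 2 → ℤ)} (h : C.IsRootSystem R) {b : A}
    {β : Fin 2 → ℤ} (hβ : β ∈ R b) : -β ∈ R b := by
  rw [h.pos_neg b] at hβ ⊢
  rcases hβ with ⟨h1, h2⟩ | ⟨h1, h2⟩
  · exact Or.inr ⟨by simpa using h1, by simpa using h2⟩
  · exact Or.inl ⟨h1, h2⟩

theorem IsRootSystem.eq_one_or {R : A → Set (Fin 2 → ℤ)} (h : C.IsRootSystem R) {b : A}
    {l : Fin 2} {x : ℤ} (hx : frame l x 0 ∈ R b) : x = 1 ∨ x = -1 := by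
  have h1 : frame l x 0 ∈ R b ∩ {β | ∃ k : ℤ, β = k • simpleRoot l} :=
    ⟨hx, x, by simp [frame]⟩
  rw [h.multiples] at h1
  rcases h1 with h1 | h1
  · rw [← frame_one_zero, frame_inj] at h1
    exact Or.inl h1.1
  · rw [Set.mem_singleton_iff, ← frame_one_zero, ← frame_neg, frame_inj] at h1
    exact Or.inr h1.1

/-- The labels alternate, so writing the reflected root in the frame of the next label exchanges the
coordinates; the fields are the root system axioms in this form. -/
theorem rootSequence (h : C.IsRootSystem C.realRoots) (i : Fin 2) (a : A) :
    RootSequence (C.entry i a) (C.rootCoords i a) where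
  fst_mem k := by
    rw [rootCoords, Set.mem_ofPred_eq, frame_one_zero]
    exact C.simpleRoot_mem_realRoots _ _
  snd_mem k := by
    rw [rootCoords, Set.mem_ofPred_eq, frame_zero_one]
    exact C.simpleRoot_mem_realRoots _ _
  sign k x y hv := by
    rw [rootCoords, Set.mem_ofPred_eq, h.pos_neg] at hv
    rcases hv with ⟨-, h1⟩ | ⟨-, h1⟩
    · exact Or.inl ((frame_nonneg _ _ _).1 h1)
    · rw [← frame_neg, frame_nonneg] at h1
      exact Or.inr ⟨by linarith, by linarith⟩
  neg_mem k x y hv := by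
    rw [rootCoords, Set.mem_ofPred_eq, frame_neg]
    exact h.neg_mem hv
  fst_mul k x hv := h.eq_one_or hv
  snd_mul k y hv := by
    rw [rootCoords, Set.mem_ofPred_eq, ← frame_swap] at hv
    exact h.eq_one_or hv
  step k x y := by
    rw [rootCoords, rootCoords, Set.mem_ofPred_eq, Set.mem_ofPred_eq, entry, label_succ,
      ← reflection_frame, walk, ← h.reflect]
    exact ((C.reflection _ _).injective.mem_set_image).symm

theorem walk_add_of_even (i : Fin 2) (a : A) {k : ℕ} (hk : Even k) (l : ℕ) :
    C.walk i a (l + k) = C.walk i (C.walk i a k) l := by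
  induction l with
  | zero => simp [walk]
  | succ l ih =>
    rw [add_right_comm, walk, ih, walk]
    simp [label, Nat.even_add, hk]

theorem walk_two_mul (i : Fin 2) (a : A) (k : ℕ) :
    C.walk i a (2 * k) = (C.ρ (i + 1) ∘ C.ρ i)^[k] a := by
  induction k with
  | zero => rfl
  | succ k ih =>
    rw [Function.iterate_succ', Function.comp_apply, ← ih]
    have h1 : ¬ Even (2 * k + 1) := by simp
    simp [show 2 * (k + 1) = 2 * k + 1 + 1 by ring, walk, label, h1]

theorem SimplyConnected.eq {I : Type} [Fintype I] [DecidableEq I] {C : CartanScheme I A}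
    (hsc : C.SimplyConnected) {b c : A} {v w : Aut I} (hv : C.Mor b c v) (hw : C.Mor b c w) : v = w := by
  have h1 : w⁻¹ * v ∈ C.End b := hv.comp hw.inv
  rw [hsc b, Subgroup.mem_bot] at h1
  exact (inv_mul_eq_one.1 h1).symm

/-- For a simply connected rank two Cartan scheme with finite root system, with `N` positive roots
at each object, the coordinates are negated after `N` steps, and the walk closes after `2 * N`
steps. -/
theorem exists_halfPeriod (hsc : C.SimplyConnected) (hfin : C.IsFiniteRootSystem C.realRoots)
    (i : Fin 2) (a : A) :
    ∃ N, 0 < N ∧ (∀ k, 0 < k → k < N → 0 < contSeq (C.entry i a) 0 1 k) ∧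
      (∀ x y, contSeq (C.entry i a) x y N = -x ∧ contSeq (C.entry i a) x y (N + 1) = -y) ∧
      C.walk i a (2 * N) = a := by
  have h := rootSequence hfin.1 i a
  obtain ⟨V, hV⟩ : ∃ V, V = {v : ℤ × ℤ | v ∈ C.rootCoords i a 0 ∧ 0 ≤ v.1 ∧ 0 ≤ v.2} := ⟨_, rfl⟩
  -- The order i + 1, i matches the Coxeter condition for `C.ρ (i + 1) ∘ C.ρ i`, which is two steps
  -- of the walk.
  obtain ⟨P, hP⟩ : ∃ P, P = C.realRoots a ∩ {β | ∃ k l : ℕ, β = k • simpleRoot (i + 1) +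
      l • simpleRoot i} := ⟨_, rfl⟩
  have hPfin : P.Finite := hP ▸ (hfin.2 a).inter_of_left _
  have hPV : P = (fun v : ℤ × ℤ => frame i v.1 v.2) '' V := by
    rw [hP, hV]
    ext β
    constructor
    · rintro ⟨h1, k, l, rfl⟩
      have h2 : k • simpleRoot (i + 1) + l • simpleRoot i = frame i (l : ℤ) (k : ℤ) := by
        rw [frame, add_comm]; simp
      rw [h2] at h1 ⊢
      exact ⟨(l, k), ⟨h1, by simp, by simp⟩, rfl⟩
    · rintro ⟨⟨x, y⟩, ⟨h1, h2, h3⟩, rfl⟩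
      obtain ⟨k, rfl⟩ := Int.eq_ofNat_of_zero_le h2
      obtain ⟨l, rfl⟩ := Int.eq_ofNat_of_zero_le h3
      exact ⟨h1, l, k, by simp [frame, add_comm]⟩
  have hcard : P.ncard = V.ncard := by
    rw [hPV]
    exact Set.ncard_image_of_injective _ fun v w hvw => Prod.ext_iff.2 (frame_inj.1 hvw)
  have hpos : 0 < P.ncard := by
    rw [Set.ncard_pos hPfin, hP]
    exact ⟨_, C.simpleRoot_mem_realRoots i a, 0, 1, by simp⟩
  have hreturn : C.walk i a (2 * P.ncard) = a := by
    rw [walk_two_mul]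
    exact hfin.1.coxeter a (i + 1) i (Fin.two_add_one_ne i) P hP hPfin
  have hone : C.walkMap i a (2 * P.ncard) = 1 := by
    have h1 := C.mor_walkMap i a (2 * P.ncard)
    rw [hreturn] at h1
    exact hsc.eq h1 (Mor.id a)
  have hu : contSeq (C.entry i a) 0 1 (2 * P.ncard) = 0 ∧
      contSeq (C.entry i a) 0 1 (2 * P.ncard + 1) = 1 := by
    have h1 := C.walkMap_frame i a 0 1 (2 * P.ncard)
    rw [hone, label_of_even i (even_two_mul _), LinearEquiv.coe_one, id, frame_inj] at h1
    exact ⟨h1.1.symm, h1.2.symm⟩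
  obtain ⟨N, hN0, hN1, hN2⟩ := h.exists_antiperiod (by omega) hu.1
  have h1 := h.ncard_pos_roots_le hN2 hN0
  have h2 := h.dvd_of_eq_one hN2 hN1 (by omega) hu.1 hu.2
  rw [← hV, ← hcard] at h1
  -- The positive roots number at most N, and the return of the state 0, 1 after `2 * P.ncard` steps
  -- needs 2N ≤ 2 * `P.ncard`.
  have h3 : P.ncard = N := by omega
  exact ⟨N, hN0, hN1, hN2, h3 ▸ hreturn⟩

section HalfPeriod

variable {i : Fin 2} {a : A} {N : ℕ}

theorem walk_add_two_mul (hret : C.walk i a (2 * N) = a) (k : ℕ) :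
    C.walk i a (k + 2 * N) = C.walk i a k := by
  rw [walk_add_of_even _ _ (even_two_mul N), hret]

theorem walk_mod (hret : C.walk i a (2 * N) = a) (k : ℕ) :
    C.walk i a (k % (2 * N)) = C.walk i a k :=
  (show Function.Periodic (C.walk i a) (2 * N) from walk_add_two_mul hret).map_mod_nat k

theorem walk_surjective (hconn : C.Connected) (hN : 0 < N) (hret : C.walk i a (2 * N) = a)
    (b : A) : ∃ k, C.walk i a k = b := by
  obtain ⟨w, hw⟩ := hconn a b
  induction hw with
  | id => exact ⟨0, rfl⟩
  | @step b w l _ ih =>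
    obtain ⟨k, rfl⟩ := ih
    rcases Fin.two_eq_or (label i k) l with rfl | rfl
    · exact ⟨k + 1, rfl⟩
    -- This label undoes the previous step; going once around the cycle first avoids the predecessor
    -- of 0.
    · obtain ⟨j, hj⟩ : ∃ j, k + 2 * N = j + 1 := ⟨k + 2 * N - 1, by omega⟩
      refine ⟨j, ?_⟩
      have h1 : label i k + 1 = label i j := by
        have h2 : label i (k + 2 * N) = label i k := by simp [label, Nat.even_add]
        rw [← h2, hj, label_succ, Fin.two_add_one_add_one]
      rw [← walk_add_two_mul hret k, hj, walk, h1, C.ρ_invol]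

/-- The morphisms along the walk are different from the identity before the walk closes. -/
theorem walkMap_ne_one (hfin : C.IsFiniteRootSystem C.realRoots)
    (hpos : ∀ k, 0 < k → k < N → 0 < contSeq (C.entry i a) 0 1 k)
    (hneg : ∀ x y, contSeq (C.entry i a) x y N = -x ∧ contSeq (C.entry i a) x y (N + 1) = -y)
    {k : ℕ} (hk0 : 0 < k) (hk : k < 2 * N) : C.walkMap i a k ≠ 1 := by
  intro hone
  have h1 := C.walkMap_frame i a 0 1 k
  have h2 := C.walkMap_frame i a 1 0 k
  rw [hone, LinearEquiv.coe_one, id] at h1 h2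
  by_cases he : Even k
  · rw [label_of_even i he, frame_inj] at h1
    have := (rootSequence hfin.1 i a).dvd_of_eq_one hneg hpos hk0 h1.1.symm h1.2.symm
    omega
  -- An odd number of reflections has determinant -1. In the swapped frame the identity would give
  -- -1 for the value computed by `contSeq.det`.
  · rw [label, if_neg he, frame_swap, frame_inj] at h1 h2
    have h3 := contSeq.det (e := C.entry i a) k
    rw [← h1.1, ← h1.2, ← h2.1, ← h2.2] at h3
    norm_num at h3

theorem walk_ne_of_lt (hsc : C.SimplyConnected) (hfin : C.IsFiniteRootSystem C.realRoots)
    (hpos : ∀ k, 0 < k → k < N → 0 < contSeq (C.entry i a) 0 1 k)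
    (hneg : ∀ x y, contSeq (C.entry i a) x y N = -x ∧ contSeq (C.entry i a) x y (N + 1) = -y)
    {k : ℕ} (hk0 : 0 < k) (hk : k < 2 * N) : C.walk i a k ≠ a := by
  intro h
  have h1 := C.mor_walkMap i a k
  rw [h] at h1
  exact walkMap_ne_one hfin hpos hneg hk0 hk (hsc.eq h1 (Mor.id a))

theorem ρ_ne (hsc : C.SimplyConnected) (l : Fin 2) (b : A) : C.ρ l b ≠ b := by
  intro h
  have h1 : C.Mor b b (C.reflection l b * 1) := by
    have h2 := Mor.step l (Mor.id (C := C) b)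
    rwa [h] at h2
  have h2 := congrArg (fun w : Aut (Fin 2) => w (frame l 1 0)) (hsc.eq h1 (Mor.id b))
  simp only [mul_one, reflection_frame, frame_swap, LinearEquiv.coe_one, id, frame_inj] at h2
  omega

/-- For even distance, undoing equally labelled last steps moves the coincidence back to the start.
For odd distance, the first and last edges have the same label, so the loop shrinks from both ends
to a fixed point of some `C.ρ l`, whose reflection would be a nontrivial endomorphism. -/
theorem walk_injOn (hsc : C.SimplyConnected) (hfin : C.IsFiniteRootSystem C.realRoots)
    (hpos : ∀ k, 0 < k → k < N → 0 < contSeq (C.entry i a) 0 1 k)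
    (hneg : ∀ x y, contSeq (C.entry i a) x y N = -x ∧ contSeq (C.entry i a) x y (N + 1) = -y)
    {x k : ℕ} (hk0 : 0 < k) (hk : x + k < 2 * N) : C.walk i a (x + k) ≠ C.walk i a x := by
  by_cases he : Even k
  · induction x with
    | zero =>
      rw [zero_add]
      exact walk_ne_of_lt hsc hfin hpos hneg hk0 (by omega)
    | succ x ih =>
      intro h
      refine ih (by omega) ?_
      have h1 : label i (x + k) = label i x := by simp [label, Nat.even_add, he]
      rw [add_right_comm, walk, walk, h1] at h
      simpa [C.ρ_invol] using congrArg (C.ρ (label i x)) h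
  · obtain ⟨j, rfl⟩ := Nat.not_even_iff_odd.1 he
    clear hk he hk0
    induction j generalizing x with
    | zero => exact ρ_ne hsc _ _
    | succ j ih =>
      intro h
      refine ih (x := x + 1) ?_
      have h1 : label i (x + (2 * (j + 1))) = label i x := by simp [label, Nat.even_add]
      change C.ρ (label i (x + 2 * (j + 1))) (C.walk i a (x + 2 * (j + 1))) = _ at h
      rw [h1] at h
      rw [show C.walk i a (x + 1) = C.ρ (label i x) (C.walk i a x) from rfl, ← h, C.ρ_invol]
      congr 1
      ring

end HalfPeriod

section Vertex

variable {i : Fin 2} {a : A} {N : ℕ}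

theorem vertex_natCast (hret : C.walk i a (2 * N) = a) (k : ℕ) :
    C.vertex N i a (k : ZMod (2 * N)) = C.walk i a k := by
  rw [vertex, ZMod.val_natCast, walk_mod hret]

theorem vertex_bijective (hconn : C.Connected) (hsc : C.SimplyConnected)
    (hfin : C.IsFiniteRootSystem C.realRoots) (hN : 0 < N)
    (hpos : ∀ k, 0 < k → k < N → 0 < contSeq (C.entry i a) 0 1 k)
    (hneg : ∀ x y, contSeq (C.entry i a) x y N = -x ∧ contSeq (C.entry i a) x y (N + 1) = -y)
    (hret : C.walk i a (2 * N) = a) : Function.Bijective (C.vertex N i a) := by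
  have : NeZero (2 * N) := ⟨by omega⟩
  constructor
  · intro x y hxy
    have key : ∀ x y : ZMod (2 * N), x.val < y.val → C.vertex N i a x ≠ C.vertex N i a y := by
      intro x y hlt h
      obtain ⟨k, hk⟩ := Nat.exists_eq_add_of_lt hlt
      have h1 := y.val_lt
      refine walk_injOn hsc hfin hpos hneg (x := x.val) (k := k + 1) (by omega) (by omega) ?_
      rw [← add_assoc, ← hk]
      exact h.symm
    rcases lt_trichotomy x.val y.val with h | h | h
    · exact absurd hxy (key x y h)
    · exact ZMod.val_injective _ h
    · exact absurd hxy.symm (key y x h)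
  · intro b
    obtain ⟨k, rfl⟩ := walk_surjective hconn hN hret b
    exact ⟨k, vertex_natCast hret k⟩

theorem card_eq (hb : Function.Bijective (C.vertex N i a)) : Nat.card A = 2 * N := by
  rw [← Nat.card_eq_of_bijective _ hb, Nat.card_zmod]

end Vertex

theorem eq_of_mor_one (hconn : C.Connected) (hsc : C.SimplyConnected)
    (hfin : C.IsFiniteRootSystem C.realRoots) {b c : A} (h : C.Mor b c 1) : b = c := by
  obtain ⟨N, hN, hpos, hneg, hret⟩ := exists_halfPeriod hsc hfin 0 b
  obtain ⟨k, rfl⟩ := walk_surjective hconn hN hret c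
  rw [← walk_mod hret] at h ⊢
  rcases Nat.eq_zero_or_pos (k % (2 * N)) with h0 | h0
  · rw [h0]; rfl
  · exact absurd (hsc.eq (C.mor_walkMap 0 b _) h)
      (walkMap_ne_one hfin hpos hneg h0 (Nat.mod_lt _ (by omega)))

end CartanScheme

/-! ### Coverings, quotients and the largest endomorphism group -/

namespace CartanScheme

section Covering

variable {I : Type} [Fintype I] [DecidableEq I] {A A' : Type u} {C : CartanScheme I A}
  {C' : CartanScheme I A'} {π : A → A'}

theorem reflection_congr {B B' : Type u} {D : CartanScheme I B} {D' : CartanScheme I B'}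
    {b : B} {b' : B'} (h : D'.cartan b' = D.cartan b) (l : I) :
    D'.reflection l b' = D.reflection l b := by
  apply LinearEquiv.ext
  intro v
  simp [reflection, Module.reflection_apply, coroot, h]

theorem IsCovering.mor_map (hπ : C.IsCovering C' π) {b c : A} {w : Aut I} (hw : C.Mor b c w) :
    C'.Mor (π b) (π c) w := by
  induction hw with
  | id => exact Mor.id _
  | step l _ ih =>
    rw [hπ.comm, ← reflection_congr (hπ.cartan_eq _) l]
    exact Mor.step l ih

theorem IsCovering.exists_lift (hπ : C.IsCovering C' π) {x y : A'} {w : Aut I}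
    (hw : C'.Mor x y w) {b : A} (hb : π b = x) : ∃ c, π c = y ∧ C.Mor b c w := by
  induction hw with
  | id => exact ⟨b, hb, Mor.id _⟩
  | step l _ ih =>
    obtain ⟨c, rfl, hc⟩ := ih
    refine ⟨C.ρ l c, hπ.comm _ _, ?_⟩
    rw [reflection_congr (hπ.cartan_eq _) l]
    exact Mor.step l hc

/-- Morphisms lift along a covering from any object in the fibre; lifting the inverse fixes the
target instead of the source. -/
theorem IsCovering.mem_end_iff (hπ : C.IsCovering C' π) {a : A} {w : Aut I} :
    w ∈ C'.End (π a) ↔ ∃ b, π b = π a ∧ C.Mor b a w := by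
  constructor
  · intro hw
    obtain ⟨b, hb, hm⟩ := hπ.exists_lift (C'.End (π a) |>.inv_mem hw) rfl
    exact ⟨b, hb, by simpa using hm.inv⟩
  · rintro ⟨b, hb, hm⟩
    have h1 := hπ.mor_map hm
    rwa [hb] at h1

end Covering

section Action

variable {I : Type} [Fintype I] [DecidableEq I] {A : Type u} (C : CartanScheme I A)
  (G : Type*) [Group G] [MulAction G A]

/-- The elements of `G` which preserve the Cartan matrices of `C`. -/
def cartanStabilizer : Subgroup G where
  carrier := {g | ∀ b, C.cartan (g • b) = C.cartan b}
  mul_mem' {g h} hg hh b := by rw [mul_smul, hg, hh]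
  one_mem' b := by rw [one_smul]
  inv_mem' {g} hg b := by rw [← hg, smul_inv_smul]

variable {C G} (hρ : ∀ (g : G) l b, g • C.ρ l b = C.ρ l (g • b))

include hρ

/-- The quotient of a Cartan scheme by the automorphisms contained in a group `G`. -/
def quotientScheme : CartanScheme I (MulAction.orbitRel.Quotient (C.cartanStabilizer G) A) where
  nonempty := C.nonempty.map (Quotient.mk _)
  ρ l := Quotient.map (C.ρ l) (by
    rintro _ b ⟨g, rfl⟩
    exact ⟨g, hρ g l b⟩)
  cartan := Quotient.lift C.cartan (by
    rintro _ b ⟨g, rfl⟩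
    exact g.2 b)
  diag := by rintro ⟨b⟩; exact C.diag b
  off_diag := by rintro ⟨b⟩; exact C.off_diag b
  zero_symm := by rintro ⟨b⟩; exact C.zero_symm b
  ρ_invol := by rintro l ⟨b⟩; exact congrArg (Quotient.mk _) (C.ρ_invol l b)
  cartan_ρ := by rintro ⟨b⟩; exact C.cartan_ρ b

theorem isCovering_quotientScheme (hconn : C.Connected) :
    C.IsCovering (quotientScheme hρ) (Quotient.mk _) := by
  have hmor : ∀ {b c : A} {w : Aut I}, C.Mor b c w →
      (quotientScheme hρ).Mor (Quotient.mk _ b) (Quotient.mk _ c) w := by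
    intro b c w hw
    induction hw with
    | id => exact Mor.id _
    | @step c w l _ ih =>
      have h1 := Mor.step l ih
      rw [reflection_congr (D := C) (D' := quotientScheme hρ) (b := c) rfl l] at h1
      exact h1
  refine ⟨hconn, ?_, fun _ => rfl, fun _ _ => rfl⟩
  rintro ⟨b⟩ ⟨c⟩
  obtain ⟨w, hw⟩ := hconn b c
  exact ⟨w, hmor hw⟩

/-- The equality propagates from a along the generators, because both g and π commute with the
object changes. -/
theorem smul_map_of_eq {A' : Type u} {C' : CartanScheme I A'} {π : A → A'}
    (hπ : C.IsCovering C' π) {a : A} {g : G} (hg : π (g • a) = π a) (b : A) :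
    π (g • b) = π b := by
  obtain ⟨w, hw⟩ := hπ.connected a b
  induction hw with
  | id => exact hg
  | step l _ ih => rw [hρ, hπ.comm, ih, hπ.comm]

theorem mem_cartanStabilizer_of_eq {A' : Type u} {C' : CartanScheme I A'} {π : A → A'}
    (hπ : C.IsCovering C' π) {a : A} {g : G} (hg : π (g • a) = π a) :
    g ∈ C.cartanStabilizer G := fun b => by
  rw [← hπ.cartan_eq, smul_map_of_eq hρ hπ hg, hπ.cartan_eq]

theorem Mor.smul {g : G} (hg : g ∈ C.cartanStabilizer G) {b c : A} {w : Aut I}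
    (hw : C.Mor b c w) : C.Mor (g • b) (g • c) w := by
  induction hw with
  | id => exact Mor.id _
  | @step c w l _ ih =>
    rw [hρ, ← reflection_congr (D' := C) (D := C) (hg c) l]
    exact Mor.step l ih

/-- An endomorphism lifts to a morphism from some b = g(a) in the fibre. As π identifies g(a) with
a, the element g preserves the Cartan matrices, so b and a also agree in the quotient. Thus the
quotient dominates every covering. -/
theorem end_le_quotientScheme [MulAction.IsPretransitive G A] {A' : Type u}
    {C' : CartanScheme I A'} {π : A → A'} (hπ : C.IsCovering C' π) (a : A) :
    C'.End (π a) ≤ (quotientScheme hρ).End (Quotient.mk _ a) := by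
  intro w hw
  obtain ⟨b, hb, hm⟩ := hπ.mem_end_iff.1 hw
  obtain ⟨g, rfl⟩ := MulAction.exists_smul_eq G a b
  refine (isCovering_quotientScheme hρ hπ.connected).mem_end_iff.2 ⟨_, ?_, hm⟩
  exact Quotient.sound ⟨⟨g, mem_cartanStabilizer_of_eq hρ hπ hb⟩, rfl⟩

theorem isMaximalCovering_quotientScheme [MulAction.IsPretransitive G A] (hconn : C.Connected)
    (a : A) : C.IsMaximalCovering (quotientScheme hρ) (Quotient.mk _) a :=
  ⟨isCovering_quotientScheme hρ hconn, fun _ _ _ hπ hle =>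
    le_antisymm (end_le_quotientScheme hρ hπ a) hle⟩

/-- The endomorphisms given by a maximal covering of a simply connected Cartan scheme, on which a
group `G` acts simply transitively, correspond to the elements of `G` preserving the Cartan
matrices. -/
theorem IsMaximalCovering.exists_mulEquiv [MulAction.IsPretransitive G A]
    (hfree : ∀ (g : G) (b : A), g • b = b → g = 1) (hsc : C.SimplyConnected)
    (hone : ∀ b c, C.Mor b c 1 → b = c) {A' : Type u} {C' : CartanScheme I A'} {π : A → A'}
    {a : A} (hπ : C.IsMaximalCovering C' π a) :
    ∃ e : C.cartanStabilizer G ≃* C'.End (π a), ∀ g : C.cartanStabilizer G,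
      π (g.1 • a) = π a ∧ (e g : Aut I) ∈ C.Hom (g.1 • a) a := by
  have hconn := hπ.1.connected
  have hend : C'.End (π a) = (quotientScheme hρ).End (Quotient.mk _ a) :=
    (hπ.2 _ _ _ (isCovering_quotientScheme hρ hconn) (end_le_quotientScheme hρ hπ.1 a)).symm
  choose w hw using fun g : C.cartanStabilizer G => hconn (g.1 • a) a
  have hwmem : ∀ g, w g ∈ C'.End (π a) := fun g => by
    rw [hend]
    exact (isCovering_quotientScheme hρ hconn).mem_end_iff.2
      ⟨_, Quotient.sound ⟨g, rfl⟩, hw g⟩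
  -- The lift of `w g` ending at a starts at some b in the fibre; composing it with the inverse of
  -- `w g` gives the identity from b to g(a), so the two objects are equal.
  have hfix : ∀ g : C.cartanStabilizer G, π (g.1 • a) = π a := fun g => by
    obtain ⟨b, hb, hm⟩ := hπ.1.mem_end_iff.1 (hwmem g)
    have h1 : C.Mor b (g.1 • a) 1 := by simpa using hm.comp (hw g).inv
    rw [← hone _ _ h1, hb]
  let f : C.cartanStabilizer G →* C'.End (π a) := MonoidHom.mk' (fun g => ⟨w g, hwmem g⟩) (by
    intro g h
    refine Subtype.ext (hsc.eq (hw (g * h)) ?_)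
    -- Translating the morphism of h by g makes it end at g(a), where that of g begins; uniqueness
    -- of morphisms gives multiplicativity.
    have h1 := ((hw h).smul hρ g.2).comp (hw g)
    rwa [← mul_smul] at h1)
  have hinj : Function.Injective f := (injective_iff_map_eq_one f).2 fun g hg => by
    have h1 := hw g
    rw [show w g = 1 from congrArg Subtype.val hg] at h1
    exact Subtype.ext (hfree _ _ (hone _ _ h1))
  have hsurj : Function.Surjective f := by
    rintro ⟨v, hv⟩
    obtain ⟨b, hb, hm⟩ := hπ.1.mem_end_iff.1 hv
    obtain ⟨g, rfl⟩ := MulAction.exists_smul_eq G a b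
    exact ⟨⟨g, mem_cartanStabilizer_of_eq hρ hπ.1 hb⟩, Subtype.ext (hsc.eq (hw _) hm)⟩
  exact ⟨MulEquiv.ofBijective f ⟨hinj, hsurj⟩, fun g => ⟨hfix g, hw g⟩⟩

end Action

end CartanScheme

/-! ### Subgroups of dihedral groups -/

/-- The embedding of a dihedral group into another one, given by a subgroup of the rotations
and one of the reflections. -/
def DihedralGroup.embedding {p n : ℕ} (f : ZMod p →+ ZMod n) (s : ZMod n) :
    DihedralGroup p →* DihedralGroup n :=
  MonoidHom.mk' (fun g => match g with
    | .r j => .r (f j)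
    | .sr j => .sr (s + f j)) (by
    rintro (j | j) (k | k)
    · simp
    · simp [add_sub_assoc]
    · simp [add_assoc]
    · simp)

/-- The homomorphism `ℤ/p → ℤ/qp` induced by multiplication with `q`. -/
def ZMod.mulHom (q p : ℕ) : ZMod p →+ ZMod (q * p) :=
  ZMod.lift p ⟨(AddMonoidHom.mulLeft (q : ZMod (q * p))).comp (Int.castAddHom _), by
    simp [← Nat.cast_mul]⟩

theorem ZMod.mulHom_intCast (q p : ℕ) (k : ℤ) :
    ZMod.mulHom q p k = ((q * k : ℤ) : ZMod (q * p)) := by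
  simp [ZMod.mulHom]

theorem ZMod.mulHom_injective {q p : ℕ} (hq : q ≠ 0) : Function.Injective (ZMod.mulHom q p) := by
  rw [injective_iff_map_eq_zero]
  intro x hx
  obtain ⟨k, rfl⟩ := ZMod.intCast_surjective x
  rw [ZMod.mulHom_intCast, ZMod.intCast_zmod_eq_zero_iff_dvd] at hx
  rw [ZMod.intCast_zmod_eq_zero_iff_dvd]
  push_cast at hx
  exact Int.dvd_of_mul_dvd_mul_left (by exact_mod_cast hq) hx

namespace DihedralGroup

variable {n q p : ℕ} {S : Subgroup (DihedralGroup n)}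

/-- Any two reflections in S differ by a rotation in S, so one reflection and the rotation lattice
determine S as the image of an embedded dihedral group. -/
theorem nonempty_mulEquiv_dihedral (hn : n = q * p) (hq : q ≠ 0)
    (hrot : ∀ k : ℤ, r (k : ZMod n) ∈ S ↔ (q : ℤ) ∣ k) {s : ZMod n} (hs : sr s ∈ S) :
    Nonempty (S ≃* DihedralGroup p) := by
  subst hn
  set f := embedding (ZMod.mulHom q p) s with hf
  have hinj : Function.Injective f := by
    rintro (j | j) (k | k) h
    · exact congrArg r (ZMod.mulHom_injective hq (r.inj h))
    · cases h
    · cases h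
    · exact congrArg sr (ZMod.mulHom_injective hq (add_left_cancel (sr.inj h)))
  have hrange : f.range = S := by
    ext g
    constructor
    · rintro ⟨g, rfl⟩
      have h1 : ∀ j : ZMod p, r (ZMod.mulHom q p j) ∈ S := fun j => by
        obtain ⟨k, rfl⟩ := ZMod.intCast_surjective j
        rw [ZMod.mulHom_intCast, hrot]
        exact dvd_mul_right _ _
      rcases g with j | j
      · exact h1 j
      · have h2 := S.mul_mem hs (h1 j)
        rwa [sr_mul_r] at h2
    · have h1 : ∀ x : ZMod (q * p), r x ∈ S → ∃ j, ZMod.mulHom q p j = x := fun x hx => by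
        obtain ⟨k, rfl⟩ := ZMod.intCast_surjective x
        obtain ⟨l, rfl⟩ := (hrot k).1 hx
        exact ⟨l, ZMod.mulHom_intCast q p l⟩
      rcases g with x | x
      · intro hx
        obtain ⟨j, rfl⟩ := h1 x hx
        exact ⟨r j, rfl⟩
      · intro hx
        have h2 := S.mul_mem hs hx
        rw [sr_mul_sr] at h2
        obtain ⟨j, hj⟩ := h1 _ h2
        refine ⟨sr j, ?_⟩
        change sr (s + ZMod.mulHom q p j) = sr x
        rw [hj, add_sub_cancel]
  rw [← hrange]
  exact ⟨(MonoidHom.ofInjective hinj).symm⟩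

theorem eq_zpowers (hrot : ∀ k : ℤ, r (k : ZMod n) ∈ S ↔ (q : ℤ) ∣ k)
    (hs : ∀ s, sr s ∉ S) : S = Subgroup.zpowers ((r 1 : DihedralGroup n) ^ q) := by
  ext g
  rw [Subgroup.mem_zpowers_iff]
  constructor
  · intro hg
    rcases g with x | x
    · obtain ⟨k, rfl⟩ := ZMod.intCast_surjective x
      obtain ⟨l, rfl⟩ := (hrot k).1 hg
      exact ⟨l, by simp⟩
    · exact absurd hg (hs x)
  · rintro ⟨l, rfl⟩
    have h1 := (hrot (q * l)).2 (dvd_mul_right _ _)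
    simpa using h1

theorem nonempty_mulEquiv_cyc (hn : n = q * p) (hn0 : n ≠ 0) :
    Nonempty (Subgroup.zpowers ((r 1 : DihedralGroup n) ^ q) ≃* Cyc p) := by
  have hq : q ≠ 0 := by rintro rfl; simp at hn; exact hn0 hn
  have hp : p ≠ 0 := by rintro rfl; simp at hn; exact hn0 hn
  have : NeZero p := ⟨hp⟩
  refine ⟨mulEquivOfCyclicCardEq ?_⟩
  rw [Nat.card_zpowers, orderOf_pow_of_dvd hq (by rw [orderOf_r_one, hn]; exact dvd_mul_right _ _),
    orderOf_r_one, hn, Nat.mul_div_cancel_left _ (Nat.pos_of_ne_zero hq)]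
  simp

theorem nonempty_mulEquiv_one : Nonempty (DihedralGroup 1 ≃* Cyc 2) :=
  ⟨mulEquivOfPrimeCardEq (p := 2) (by rw [nat_card]) (by simp)⟩

theorem nonempty_mulEquiv_two : Nonempty (DihedralGroup 2 ≃* Cyc 2 × Cyc 2) := by
  have : IsKleinFour (Cyc 2 × Cyc 2) :=
    { card_four := by simp
      exponent_two := by simp [Monoid.exponent_prod] }
  exact IsKleinFour.nonempty_mulEquiv

end DihedralGroup

/-! ### Periods and reflections of cyclic sequences -/

theorem seqPow_map_range (f : ℕ → ℤ) (m r : ℕ) :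
    seqPow ((List.range m).map f) r = (List.range (r * m)).map fun k => f (k % m) := by
  induction r with
  | zero => simp [seqPow]
  | succ r ih =>
    have h1 : seqPow ((List.range m).map f) (r + 1) =
        seqPow ((List.range m).map f) r ++ (List.range m).map f := by
      simp [seqPow, List.replicate_succ']
    rw [h1, ih, add_mul, one_mul, List.range_add, List.map_append, List.map_map]
    congr 1
    refine List.map_congr_left fun k hk => ?_
    simp [Nat.mod_eq_of_lt (List.mem_range.1 hk)]

theorem List.exists_eq_map_range (d : List ℤ) : ∃ f : ℕ → ℤ, d = (List.range d.length).map f :=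
  ⟨fun k => d.getD k 0, List.ext_getElem (by simp) fun k h1 h2 => by simp [h1]⟩

/-- A periodic function on the integers with period `n`, whose values on `0, …, n - 1` form the
`r`-th power of a sequence with `r` maximal, has period lattice generated by the length of this
sequence. -/
theorem isPeriod_iff_dvd {f : ℤ → ℤ} {n : ℕ} (hn : 0 < n) (hf : ∀ x, f (x + n) = f x)
    {d : List ℤ} {r : ℕ} (hc : (List.range n).map (fun k : ℕ => f k) = seqPow d r)
    (hmax : ∀ (d' : List ℤ) (r' : ℕ),
      (List.range n).map (fun k : ℕ => f k) = seqPow d' r' → r' ≤ r) :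
    r * d.length = n ∧ ∀ k : ℤ, (∀ x, f (x + k) = f x) ↔ (d.length : ℤ) ∣ k := by
  obtain ⟨g, hg⟩ := d.exists_eq_map_range
  generalize d.length = m at hg
  subst hg
  rw [seqPow_map_range] at hc
  have hmr : r * m = n := by simpa using (congrArg List.length hc).symm
  have hm0 : 0 < m := Nat.pos_of_ne_zero (by rintro rfl; omega)
  have hr0 : 0 < r := Nat.pos_of_ne_zero (by rintro rfl; omega)
  refine ⟨hmr, fun k => ?_⟩
  have hper : Function.Periodic f (n : ℤ) := hf
  have hval : ∀ x : ℤ, f x = g ((x % m).toNat) := by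
    intro x
    have h1 : 0 ≤ x % n := Int.emod_nonneg _ (by omega)
    have h2 : x % n < n := Int.emod_lt_of_pos _ (by omega)
    obtain ⟨y, hy⟩ := Int.eq_ofNat_of_zero_le h1
    have h3 : f x = f (x % n) := by
      conv_lhs => rw [← Int.emod_add_mul_ediv x n, mul_comm]
      exact (hper.int_mul _) _
    have h4 : f y = g (y % m) := by
      have hy2 : y < n := by omega
      rw [← hmr] at hc hy2
      have h5 := List.map_inj_left.1 hc y (List.mem_range.2 hy2)
      exact h5
    have h5 : x % m = y % m := by
      rw [← hy, Int.emod_emod_of_dvd]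
      exact_mod_cast Dvd.intro_left r hmr
    rw [h3, hy, h4, h5]
    congr 1
  have hm : Function.Periodic f (m : ℤ) := fun x => by rw [hval, hval x]; simp
  constructor
  · intro hk
    have hk' : Function.Periodic f k := hk
    -- By Bézout the gcd of two periods is a period. It divides m, so it yields an `r * t`-th power,
    -- and maximality of r forces t = 1.
    have hq : Function.Periodic f ((Int.gcd k m : ℕ) : ℤ) := by
      rw [Int.gcd_eq_gcd_ab, mul_comm k, mul_comm (m : ℤ)]
      exact (hk'.int_mul _).add_period (hm.int_mul _)
    set q := Int.gcd k m with hqdef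
    have hqm : q ∣ m := by exact_mod_cast Int.gcd_dvd_right k m
    have hqk : (q : ℤ) ∣ k := Int.gcd_dvd_left k m
    obtain ⟨t, ht⟩ := hqm
    have hpow : (List.range n).map (fun k : ℕ => f k) =
        seqPow ((List.range q).map (fun k : ℕ => f k)) (r * t) := by
      rw [seqPow_map_range, mul_assoc, mul_comm t q, ← ht, hmr]
      refine List.map_congr_left fun k _ => ?_
      conv_lhs => rw [← Nat.mod_add_div k q]
      push_cast
      rw [mul_comm]
      exact (hq.int_mul _) _
    have h1 := hmax _ _ hpow
    have h2 : t = 1 := by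
      have ht0 : 0 < t := Nat.pos_of_ne_zero (by rintro rfl; omega)
      have := Nat.le_of_mul_le_mul_left (h1.trans_eq (mul_one r).symm) hr0
      omega
    rw [h2, mul_one] at ht
    rwa [ht]
  · rintro ⟨t, rfl⟩
    rw [mul_comm]
    exact hm.int_mul t

/-- Type 1 at position k, counted from 0, says that f is symmetric about k. With s = -2k - 1 this is
x ↦ -x - s - 1, so s is automatically odd, as for the reflections in H. -/
theorem isTypeOne_iff {f : ℤ → ℤ} {n : ℕ} (hn : 0 < n) (hf : ∀ x, f (x + n) = f x) :
    IsTypeOne ((List.range n).map fun k : ℕ => f k) ↔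
      ∃ s : ℤ, Odd s ∧ ∀ x, f (-x - s - 1) = f x := by
  have hper : Function.Periodic f (n : ℤ) := hf
  have hmod : ∀ x : ℕ, f ((x % n : ℕ) : ℤ) = f x := fun x => by
    conv_rhs => rw [← Nat.mod_add_div x n]
    push_cast
    rw [mul_comm]
    exact ((hper.int_mul _) _).symm
  have key : ∀ k : ℕ, ((List.range n).map fun k : ℕ => f k).rotate k =
      (((List.range n).map fun k : ℕ => f k).rotate (k + 1)).reverse ↔
      ∀ t : ℤ, f (k + t) = f (k - t) := fun k => by
    have hget : ∀ t : ℕ, t < n → ((f ((t + k : ℕ) : ℤ) = f ((n - 1 - t + (k + 1) : ℕ) : ℤ)) ↔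
        f (k + t) = f (k - t)) := fun t ht => by
      have h1 : ((n - 1 - t + (k + 1) : ℕ) : ℤ) = (k - t : ℤ) + n := by omega
      rw [h1, hf, Nat.cast_add, add_comm (t : ℤ)]
    constructor
    · intro h t
      have h1 : 0 ≤ t % n := Int.emod_nonneg _ (by omega)
      have h2 : t % n < n := Int.emod_lt_of_pos _ (by omega)
      obtain ⟨y, hy⟩ := Int.eq_ofNat_of_zero_le h1
      have hyn : y < n := by omega
      have h3 := List.getElem_of_eq h (i := y) (by simpa using hyn)
      simp only [List.getElem_rotate, List.getElem_reverse, List.getElem_map, List.getElem_range,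
        List.length_map, List.length_range, List.length_rotate, hmod] at h3
      have h4 := (hget y hyn).1 h3
      have ht : t = y + (t / n) * n := by
        rw [← hy, mul_comm, Int.emod_add_mul_ediv]
      have h5 : f (k + t) = f (k + y) := by
        rw [ht, ← add_assoc]; exact hper.int_mul _ _
      have h6 : f (k - t) = f (k - y) := by
        rw [ht, ← sub_sub]; exact hper.sub_int_mul_eq _
      rw [h5, h6, h4]
    · intro h
      refine List.ext_getElem (by simp) fun t h1 h2 => ?_
      have ht : t < n := by simpa using h1
      simp only [List.getElem_rotate, List.getElem_reverse, List.getElem_map, List.getElem_range,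
        List.length_map, List.length_range, List.length_rotate, hmod]
      exact (hget t ht).2 (h t)
  constructor
  · rintro ⟨k, -, hk⟩
    refine ⟨-2 * k - 1, ⟨-k - 1, by ring⟩, fun x => ?_⟩
    have h1 := (key k).1 hk (x - k)
    rw [add_sub_cancel] at h1
    rw [h1]
    congr 1
    ring
  -- The centre of the symmetry is -j - 1, reduced modulo n to an admissible position.
  · rintro ⟨s, ⟨j, rfl⟩, hs⟩
    have h1 : 0 ≤ (-j - 1) % n := Int.emod_nonneg _ (by omega)
    have h2 : (-j - 1) % n < n := Int.emod_lt_of_pos _ (by omega)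
    obtain ⟨k, hk⟩ := Int.eq_ofNat_of_zero_le h1
    refine ⟨k, by simp; omega, (key k).2 fun t => ?_⟩
    have h3 : -j - 1 = k + ((-j - 1) / n) * n := by
      rw [← hk, mul_comm, Int.emod_add_mul_ediv]
    rw [← hs (k + t), show -(k + t : ℤ) - (2 * j + 1) - 1 =
      (k - t) + (2 * ((-j - 1) / n)) * n by linear_combination 2 * h3]
    exact hper.int_mul _ _

theorem intCast_even_iff {n : ℕ} {k l : ℤ} (h : (k : ZMod (2 * n)) = l) : Even k ↔ Even l := by
  rw [ZMod.intCast_eq_intCast_iff_dvd_sub] at h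
  have h1 : Even (l - k) := (even_iff_two_dvd).2 ((Dvd.intro _ (by push_cast; rfl)).trans h)
  rw [Int.even_sub] at h1
  exact h1.symm

theorem r_mem_subgroupH_iff {n : ℕ} (k : ℤ) :
    DihedralGroup.r (k : ZMod (2 * n)) ∈ subgroupH n ↔ Even k := by
  constructor
  · rintro ⟨j, hj | hj⟩
    · have h1 : DihedralGroup.r (k : ZMod (2 * n)) = .r ((2 * j : ℤ) : ZMod (2 * n)) := by
        rw [hj]; simp [dihedralμ]
      exact (intCast_even_iff (DihedralGroup.r.inj h1)).2 (even_two_mul j)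
    · simp [dihedralμ, dihedralτ] at hj
  · rintro ⟨j, rfl⟩
    exact ⟨j, Or.inl (by simp [dihedralμ, two_mul])⟩

theorem sr_mem_subgroupH_iff {n : ℕ} (k : ℤ) :
    DihedralGroup.sr (k : ZMod (2 * n)) ∈ subgroupH n ↔ Odd k := by
  constructor
  · rintro ⟨j, hj | hj⟩
    · simp [dihedralμ] at hj
    · have h1 : DihedralGroup.sr (k : ZMod (2 * n)) = .sr ((2 * j + 1 : ℤ) : ZMod (2 * n)) := by
        rw [hj]; simp [dihedralμ, dihedralτ]
      rw [← Int.not_even_iff_odd, intCast_even_iff (DihedralGroup.sr.inj h1), Int.not_even_iff_odd]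
      exact ⟨j, rfl⟩
  · rintro ⟨j, rfl⟩
    exact ⟨j, Or.inr (by simp [dihedralμ, dihedralτ])⟩

theorem r_smul {n : ℕ} (k x : ZMod (2 * n)) : DihedralGroup.r k • x = x + k := rfl

theorem sr_smul {n : ℕ} (k x : ZMod (2 * n)) : DihedralGroup.sr k • x = -(x + k) := rfl

/-! ### Symmetries of the object change diagram -/

namespace CartanScheme

variable {A : Type u} (C : CartanScheme (Fin 2) A) {n : ℕ} {i : Fin 2} {a : A}

/-- The label of the edge between the vertices `x` and `x + 1`. -/
def intLabel (i : Fin 2) (x : ℤ) : Fin 2 := if Even x then i else i + 1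

theorem intLabel_add_of_even (i : Fin 2) (x : ℤ) {k : ℤ} (hk : Even k) :
    intLabel i (x + k) = intLabel i x := by
  simp [intLabel, Int.even_add, hk]

theorem intLabel_neg (i : Fin 2) (x : ℤ) : intLabel i (-x) = intLabel i x := by
  simp [intLabel]

theorem intLabel_add_one (i : Fin 2) (x : ℤ) : intLabel i (x + 1) = intLabel i x + 1 := by
  by_cases h : Even x <;> simp [intLabel, h, Fin.two_add_one_add_one]

theorem intLabel_natCast (i : Fin 2) (k : ℕ) : intLabel i k = label i k := by
  simp [intLabel, label]

/-- The negated Cartan entry belonging to the edge between the vertices `x` and `x + 1`. -/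
def edge (n : ℕ) (i : Fin 2) (a : A) (x : ℤ) : ℤ :=
  -C.cartan (C.vertex n i a (x : ZMod (2 * n))) (intLabel i x) (intLabel i x + 1)

theorem exists_natCast_eq (hn : 0 < n) (x : ℤ) :
    ∃ k : ℕ, ((x : ℤ) : ZMod (2 * n)) = ((k : ℤ) : ZMod (2 * n)) := by
  refine ⟨(x % (2 * n : ℕ)).toNat, ?_⟩
  rw [Int.toNat_of_nonneg (Int.emod_nonneg _ (by omega)), ZMod.intCast_mod]

theorem intLabel_congr {x y : ℤ} (h : (x : ZMod (2 * n)) = (y : ZMod (2 * n))) :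
    intLabel i x = intLabel i y := by
  simp [intLabel, intCast_even_iff h]

variable {C}

theorem vertex_add_one (hn : 0 < n) (hret : C.walk i a (2 * n) = a) (x : ℤ) :
    C.vertex n i a ((x + 1 : ℤ) : ZMod (2 * n)) =
      C.ρ (intLabel i x) (C.vertex n i a (x : ZMod (2 * n))) := by
  obtain ⟨k, hk⟩ := exists_natCast_eq hn x
  rw [Int.cast_add, intLabel_congr hk, hk, intLabel_natCast, Int.cast_natCast,
    vertex_natCast hret, Int.cast_one, ← Nat.cast_succ, vertex_natCast hret]
  rfl

theorem edge_natCast (hret : C.walk i a (2 * n) = a) (k : ℕ) :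
    C.edge n i a k = C.entry i a k := by
  rw [edge, Int.cast_natCast, vertex_natCast hret, intLabel_natCast, entry, label_succ]

theorem edge_periodic (hn : 0 < n) (hret : C.walk i a (2 * n) = a)
    (hper : ∀ k, C.entry i a (k + n) = C.entry i a k) (x : ℤ) :
    C.edge n i a (x + n) = C.edge n i a x := by
  have hcongr : ∀ {x y : ℤ}, (x : ZMod (2 * n)) = (y : ZMod (2 * n)) →
      C.edge n i a x = C.edge n i a y := fun h => by rw [edge, edge, h, intLabel_congr h]
  obtain ⟨k, hk⟩ := exists_natCast_eq hn x
  rw [hcongr hk, hcongr (y := ((k + n : ℕ) : ℤ)) (by push_cast at hk ⊢; rw [hk]),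
    edge_natCast hret, edge_natCast hret, hper]

/-- Both ends of an edge share the row of the Cartan matrix belonging to its label. So the two
off-diagonal entries at a vertex are the values on its two edges, and preserving Cartan matrices
means preserving edge values. -/
theorem edge_sub_one (hn : 0 < n) (hret : C.walk i a (2 * n) = a) (x : ℤ) :
    C.edge n i a (x - 1) =
      -C.cartan (C.vertex n i a (x : ZMod (2 * n))) (intLabel i x + 1) (intLabel i x) := by
  have h1 := vertex_add_one hn hret (x - 1)
  have h2 := intLabel_add_one i (x - 1)
  rw [sub_add_cancel] at h1 h2
  rw [edge, h1, h2, Fin.two_add_one_add_one, ← h2, h2, ← C.cartan_ρ]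

theorem cartan_ext {b c : A} (l : Fin 2) (h1 : C.cartan b l (l + 1) = C.cartan c l (l + 1))
    (h2 : C.cartan b (l + 1) l = C.cartan c (l + 1) l) : C.cartan b = C.cartan c := by
  ext j k
  rcases Fin.two_eq_or l j with hj | hj <;> rcases Fin.two_eq_or l k with hk | hk <;>
    rw [hj, hk]
  · rw [C.diag, C.diag]
  · exact h1
  · exact h2
  · rw [C.diag, C.diag]

theorem cartan_vertex_add_iff (hn : 0 < n) (hret : C.walk i a (2 * n) = a) {k : ℤ}
    (hk : Even k) : (∀ x : ℤ, C.cartan (C.vertex n i a ((x + k : ℤ) : ZMod (2 * n))) =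
      C.cartan (C.vertex n i a (x : ZMod (2 * n)))) ↔
      ∀ x, C.edge n i a (x + k) = C.edge n i a x := by
  constructor
  · intro h x
    rw [edge, edge, h, intLabel_add_of_even i x hk]
  · intro h x
    have h1 := h x
    have h2 := h (x - 1)
    rw [sub_add_eq_add_sub, edge_sub_one hn hret, edge_sub_one hn hret,
      intLabel_add_of_even i x hk] at h2
    rw [edge, edge, intLabel_add_of_even i x hk] at h1
    exact cartan_ext (intLabel i x) (neg_inj.1 h1) (neg_inj.1 h2)

/-- The reflection x ↦ -(x + s) sends the edge from x to x + 1 to the one starting at -x - s - 1;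
for odd s it keeps edge labels, but exchanges incoming and outgoing edges. -/
theorem cartan_vertex_neg_iff (hn : 0 < n) (hret : C.walk i a (2 * n) = a) {s : ℤ}
    (hs : Odd s) : (∀ x : ℤ, C.cartan (C.vertex n i a ((-(x + s) : ℤ) : ZMod (2 * n))) =
      C.cartan (C.vertex n i a (x : ZMod (2 * n)))) ↔
      ∀ x, C.edge n i a (-x - s - 1) = C.edge n i a x := by
  have hl : ∀ x, intLabel i (-(x + s)) = intLabel i x + 1 := fun x => by
    obtain ⟨j, rfl⟩ := hs
    rw [intLabel_neg, ← add_assoc, intLabel_add_one, intLabel_add_of_even i x (even_two_mul j)]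
  constructor
  · intro h x
    rw [show -x - s - 1 = -(x + s) - 1 by ring, edge_sub_one hn hret, h, hl, edge,
      Fin.two_add_one_add_one]
  · intro h x
    have h1 := h x
    have h2 := h (x - 1)
    rw [show -x - s - 1 = -(x + s) - 1 by ring, edge_sub_one hn hret, hl, edge,
      Fin.two_add_one_add_one] at h1
    rw [show -(x - 1) - s - 1 = -(x + s) by ring, edge_sub_one hn hret, edge, hl,
      Fin.two_add_one_add_one] at h2
    exact cartan_ext (intLabel i x) (neg_inj.1 h1) (neg_inj.1 h2)

section SubgroupAction

/-- The action of the group of label preserving automorphisms of the object change diagram on the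
set of objects. -/
noncomputable abbrev subgroupHAction (hb : Function.Bijective (C.vertex n i a)) :
    MulAction (subgroupH n) A :=
  (Equiv.ofBijective _ hb).symm.mulAction (subgroupH n)

variable (hb : Function.Bijective (C.vertex n i a))

theorem subgroupHAction_smul (g : subgroupH n) (x : ZMod (2 * n)) :
    letI := subgroupHAction hb
    g • C.vertex n i a x = C.vertex n i a (g.1 • x) := by
  have h1 : (Equiv.ofBijective _ hb).symm (C.vertex n i a x) = x :=
    (Equiv.ofBijective _ hb).symm_apply_apply x
  change Equiv.ofBijective _ hb (g • (Equiv.ofBijective _ hb).symm (C.vertex n i a x)) = _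
  rw [h1]
  rfl

theorem exists_intCast_vertex_eq (hb : Function.Bijective (C.vertex n i a)) (b : A) :
    ∃ x : ℤ, C.vertex n i a (x : ZMod (2 * n)) = b := by
  obtain ⟨x, rfl⟩ := hb.2 b
  obtain ⟨y, rfl⟩ := ZMod.intCast_surjective x
  exact ⟨y, rfl⟩

theorem subgroupH_cases (g : subgroupH n) :
    (∃ k : ℤ, Even k ∧ g.1 = .r (k : ZMod (2 * n))) ∨
      ∃ k : ℤ, Odd k ∧ g.1 = .sr (k : ZMod (2 * n)) := by
  obtain ⟨g, k, rfl | rfl⟩ := g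
  · exact Or.inl ⟨2 * k, even_two_mul k, by simp [dihedralμ]⟩
  · exact Or.inr ⟨2 * k + 1, ⟨k, rfl⟩, by simp [dihedralμ, dihedralτ]⟩

theorem subgroupHAction_ρ (hn : 0 < n) (hret : C.walk i a (2 * n) = a) (g : subgroupH n)
    (l : Fin 2) (b : A) :
    letI := subgroupHAction hb
    g • C.ρ l b = C.ρ l (g • b) := by
  let := subgroupHAction hb
  have key : ∀ x : ℤ, g • C.ρ (intLabel i x) (C.vertex n i a (x : ZMod (2 * n))) =
      C.ρ (intLabel i x) (g • C.vertex n i a (x : ZMod (2 * n))) := by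
    intro x
    rw [← vertex_add_one hn hret, subgroupHAction_smul, subgroupHAction_smul]
    rcases subgroupH_cases g with ⟨k, hk, hg⟩ | ⟨k, ⟨j, rfl⟩, hg⟩
    · rw [hg, r_smul, r_smul, ← Int.cast_add, ← Int.cast_add, ← intLabel_add_of_even i x hk,
        ← vertex_add_one hn hret, add_right_comm]
    · have h1 := vertex_add_one hn hret (-(x + 1 + (2 * j + 1)))
      have h2 : intLabel i (-(x + 1 + (2 * j + 1))) = intLabel i x := by
        rw [intLabel_neg, show x + 1 + (2 * j + 1) = x + 2 * (j + 1) by ring,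
          intLabel_add_of_even i x (even_two_mul _)]
      rw [h2, show -(x + 1 + (2 * j + 1)) + 1 = -(x + (2 * j + 1)) by ring] at h1
      rw [hg, sr_smul, sr_smul, ← Int.cast_add, ← Int.cast_add, ← Int.cast_neg, ← Int.cast_neg,
        h1, C.ρ_invol]
  obtain ⟨x, rfl⟩ := exists_intCast_vertex_eq hb b
  rcases Fin.two_eq_or (intLabel i x) l with rfl | rfl
  · exact key x
  -- The other label at x belongs to the preceding edge, traversed backwards.
  · have h1 := key (x - 1)
    have h2 := vertex_add_one hn hret (x - 1)
    have h3 := intLabel_add_one i (x - 1)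
    rw [sub_add_cancel] at h2 h3
    rw [h3, Fin.two_add_one_add_one, h2, C.ρ_invol, h1, C.ρ_invol]

/-- Vertices of equal parity differ by an even rotation; vertices of different parity are exchanged
by an odd reflection. Since odd reflections change parity, they have no fixed vertex, so the action
is also free. -/
theorem subgroupHAction_isPretransitive :
    letI := subgroupHAction hb
    MulAction.IsPretransitive (subgroupH n) A := by
  let := subgroupHAction hb
  refine ⟨fun b c => ?_⟩
  obtain ⟨x, rfl⟩ := exists_intCast_vertex_eq hb b
  obtain ⟨y, rfl⟩ := exists_intCast_vertex_eq hb c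
  by_cases h : Even (y - x)
  · refine ⟨⟨_, (r_mem_subgroupH_iff (y - x)).2 h⟩, ?_⟩
    rw [subgroupHAction_smul, r_smul, ← Int.cast_add, add_sub_cancel]
  · have h1 : Odd (-(y + x)) := by
      rw [← Int.not_even_iff_odd]
      rwa [even_neg, Int.even_add, ← Int.even_sub]
    refine ⟨⟨_, (sr_mem_subgroupH_iff (-(y + x))).2 h1⟩, ?_⟩
    rw [subgroupHAction_smul, sr_smul, ← Int.cast_add, ← Int.cast_neg]
    congr 2
    ring

theorem subgroupHAction_free (g : subgroupH n) (b : A)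
    (h : letI := subgroupHAction hb; g • b = b) : g = 1 := by
  let := subgroupHAction hb
  obtain ⟨x, rfl⟩ := exists_intCast_vertex_eq hb b
  change g • C.vertex n i a (x : ZMod (2 * n)) = _ at h
  rw [subgroupHAction_smul] at h
  have h1 := hb.1 h
  rcases subgroupH_cases g with ⟨k, -, hg⟩ | ⟨k, hk, hg⟩
  · rw [hg, r_smul, add_eq_left] at h1
    rw [h1] at hg
    exact Subtype.ext hg
  · rw [hg, sr_smul, ← Int.cast_add, ← Int.cast_neg] at h1
    have h2 := intCast_even_iff h1
    rw [even_neg, Int.even_add] at h2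
    have := Int.not_even_iff_odd.2 hk
    tauto

/-- The subgroup of the automorphisms of the object change diagram which preserve the labels and
the Cartan matrices. -/
noncomputable def diagramStabilizer (hb : Function.Bijective (C.vertex n i a)) :
    Subgroup (DihedralGroup (2 * n)) :=
  letI := subgroupHAction hb
  (C.cartanStabilizer (subgroupH n)).map (subgroupH n).subtype

theorem diagramStabilizer_le : diagramStabilizer hb ≤ subgroupH n :=
  Subgroup.map_subtype_le _

theorem mem_diagramStabilizer_iff (g : DihedralGroup (2 * n)) :
    g ∈ diagramStabilizer hb ↔ g ∈ subgroupH n ∧ ∀ x : ℤ,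
      C.cartan (C.vertex n i a (g • (x : ZMod (2 * n)))) =
        C.cartan (C.vertex n i a (x : ZMod (2 * n))) := by
  let := subgroupHAction hb
  constructor
  · rintro ⟨g, hg, rfl⟩
    refine ⟨g.2, fun x => ?_⟩
    have h1 := hg (C.vertex n i a (x : ZMod (2 * n)))
    rwa [subgroupHAction_smul] at h1
  · rintro ⟨hg, h⟩
    refine ⟨⟨g, hg⟩, fun b => ?_, rfl⟩
    obtain ⟨x, rfl⟩ := exists_intCast_vertex_eq hb b
    rw [subgroupHAction_smul]
    exact h x

theorem r_mem_diagramStabilizer_iff (hn : 0 < n) (hret : C.walk i a (2 * n) = a) (k : ℤ) :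
    .r (k : ZMod (2 * n)) ∈ diagramStabilizer hb ↔
      Even k ∧ ∀ x, C.edge n i a (x + k) = C.edge n i a x := by
  rw [mem_diagramStabilizer_iff, r_mem_subgroupH_iff]
  refine and_congr_right fun hk => ?_
  rw [← cartan_vertex_add_iff hn hret hk]
  simp only [r_smul, Int.cast_add]

theorem sr_mem_diagramStabilizer_iff (hn : 0 < n) (hret : C.walk i a (2 * n) = a) (k : ℤ) :
    .sr (k : ZMod (2 * n)) ∈ diagramStabilizer hb ↔
      Odd k ∧ ∀ x, C.edge n i a (-x - k - 1) = C.edge n i a x := by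
  rw [mem_diagramStabilizer_iff, sr_mem_subgroupH_iff]
  refine and_congr_right fun hk => ?_
  rw [← cartan_vertex_neg_iff hn hret hk]
  simp only [sr_smul, Int.cast_add, Int.cast_neg]

theorem endGivenBy_diagramStabilizer (hsc : C.SimplyConnected)
    (hfin : C.IsFiniteRootSystem C.realRoots) (hn : 0 < n) (hret : C.walk i a (2 * n) = a)
    {A' : Type u} {C' : CartanScheme (Fin 2) A'} {π : A → A'} (hπ : C.IsMaximalCovering C' π a) :
    C.EndGivenBy C' π n i a (diagramStabilizer hb) := by
  let := subgroupHAction hb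
  have := subgroupHAction_isPretransitive hb
  obtain ⟨e, he⟩ := hπ.exists_mulEquiv (subgroupHAction_ρ hb hn hret) (subgroupHAction_free hb)
    hsc (fun _ _ h => eq_of_mor_one hπ.1.connected hsc hfin h)
  obtain ⟨f, hf⟩ : ∃ f : C.cartanStabilizer (subgroupH n) ≃* diagramStabilizer hb,
      ∀ g, (f g).1 = g.1.1 :=
    ⟨(C.cartanStabilizer (subgroupH n)).equivMapOfInjective _ (subgroupH n).subtype_injective,
      fun _ => rfl⟩
  refine ⟨f.symm.trans e, fun g => ?_⟩
  obtain ⟨g, rfl⟩ := f.surjective g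
  have h1 := he g
  have h2 : g.1 • a = C.vertex n i a (g.1.1 • (0 : ZMod (2 * n))) := by
    rw [← subgroupHAction_smul hb]
    congr 1
    exact (vertex_natCast hret 0).symm.trans (by simp)
  rw [h2] at h1
  rw [MulEquiv.trans_apply, MulEquiv.symm_apply_apply, hf]
  exact h1

end SubgroupAction

end CartanScheme

/-! ### The classification -/

theorem proposition3p12 {A : Type u} (C : CartanScheme (Fin 2) A)
    (hconn : C.Connected) (hsc : C.SimplyConnected)
    (hfin : C.IsFiniteRootSystem C.realRoots) (hirr : C.Irreducible)
    (i : Fin 2) (a : A) (n : ℕ) (hn : n = Nat.card A / 2)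
    (d : List ℤ) (r m : ℕ) (hc : C.Phi n i a = seqPow d r)
    (hmax : ∀ (d' : List ℤ) (r' : ℕ), C.Phi n i a = seqPow d' r' → r' ≤ r)
    (hm : m = d.length) :
    (r = 1 ∨ r = 2 ∨ r = 3) ∧ Nat.card A = 2 * n ∧ 0 < n ∧ m * r = n ∧
    Function.Bijective (C.vertex n i a) ∧
    (∃ (A' : Type u) (C' : CartanScheme (Fin 2) A') (π : A → A'), C.IsMaximalCovering C' π a) ∧
    ∀ (A' : Type u) (C' : CartanScheme (Fin 2) A') (π : A → A'), C.IsMaximalCovering C' π a →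
      ∃ S : Subgroup (DihedralGroup (2 * n)),
        S ≤ subgroupH n ∧ C.EndGivenBy C' π n i a S ∧
        (Even m → IsTypeOne (C.Phi n i a) →
          (r = 1 → Nonempty (S ≃* Cyc 2 × Cyc 2)) ∧
          (r = 2 → Nonempty (S ≃* DihedralGroup 4)) ∧
          (r = 3 → Nonempty (S ≃* DihedralGroup 6))) ∧
        (Even m → ¬ IsTypeOne (C.Phi n i a) →
          (r = 1 → S = Subgroup.zpowers (dihedralμ n ^ n) ∧
            Nonempty (S ≃* Cyc 2)) ∧
          (r = 2 → S = Subgroup.zpowers (dihedralμ n ^ (n / 2)) ∧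
            Nonempty (S ≃* Cyc 4)) ∧
          (r = 3 → S = Subgroup.zpowers (dihedralμ n ^ (n / 3)) ∧
            Nonempty (S ≃* Cyc 6))) ∧
        (Odd m → IsTypeOne (C.Phi n i a) →
          (r = 1 → Nonempty (S ≃* Cyc 2)) ∧
          (r = 2 → Nonempty (S ≃* Cyc 2 × Cyc 2)) ∧
          (r = 3 → Nonempty (S ≃* DihedralGroup 3))) ∧
        (Odd m → ¬ IsTypeOne (C.Phi n i a) →
          (r = 1 → S = ⊥) ∧
          (r = 2 → S = Subgroup.zpowers (dihedralμ n ^ n) ∧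
            Nonempty (S ≃* Cyc 2)) ∧
          (r = 3 → S = Subgroup.zpowers (dihedralμ n ^ (2 * n / 3)) ∧
            Nonempty (S ≃* Cyc 3))) := by

  obtain ⟨N, hN, hpos, hneg, hret⟩ := C.exists_halfPeriod hsc hfin i a
  have hb := CartanScheme.vertex_bijective hconn hsc hfin hN hpos hneg hret
  have hcard := CartanScheme.card_eq hb
  obtain rfl : n = N := by omega
  have hper := (CartanScheme.rootSequence hfin.1 i a).periodic hneg
  have hedge := CartanScheme.edge_periodic hN hret hper
  have hPhi : C.Phi n i a = (List.range n).map fun k : ℕ => C.edge n i a k :=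
    List.map_congr_left fun k _ => (CartanScheme.edge_natCast hret k).symm
  have htype := isTypeOne_iff hN hedge
  rw [hPhi] at hc
  simp only [hPhi] at hmax
  obtain ⟨hrm, hperiod⟩ := isPeriod_iff_dvd hN hedge hc hmax
  rw [← hm] at hrm hperiod
  rw [← hPhi] at htype
  have hm0 : 0 < m := Nat.pos_of_ne_zero (by rintro rfl; omega)
  have hr0 : 0 < r := Nat.pos_of_ne_zero (by rintro rfl; omega)
  have hr : r ≤ 3 := by
    refine contSeq.le_three_of_periodic (e := C.entry i a) (m := m) (fun k => ?_) ?_ ?_ hm0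
    · rw [← CartanScheme.edge_natCast hret, ← CartanScheme.edge_natCast hret, Nat.cast_add]
      exact (hperiod m).2 dvd_rfl k
    · rwa [hrm]
    · rw [hrm, (hneg 0 1).1, neg_zero]
  refine ⟨by omega, hcard, hN, by rw [mul_comm, hrm], hb, ?_, fun A' C' π hπ => ?_⟩
  · let := CartanScheme.subgroupHAction hb
    have := CartanScheme.subgroupHAction_isPretransitive hb
    exact ⟨_, _, _, CartanScheme.isMaximalCovering_quotientScheme
      (CartanScheme.subgroupHAction_ρ hb hN hret) hconn a⟩
  have hr_mem := CartanScheme.r_mem_diagramStabilizer_iff hb hN hret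
  have hsr_mem := CartanScheme.sr_mem_diagramStabilizer_iff hb hN hret
  refine ⟨CartanScheme.diagramStabilizer hb, CartanScheme.diagramStabilizer_le hb,
    CartanScheme.endGivenBy_diagramStabilizer hb hsc hfin hN hret hπ, ?_⟩
  generalize CartanScheme.diagramStabilizer hb = S at hr_mem hsr_mem
  have hsr1 : IsTypeOne (C.Phi n i a) → ∃ s, DihedralGroup.sr s ∈ S := fun h => by
    obtain ⟨s, hs⟩ := htype.1 h
    exact ⟨_, (hsr_mem s).2 hs⟩
  have hsr2 : ¬ IsTypeOne (C.Phi n i a) → ∀ s, DihedralGroup.sr s ∉ S := fun h s hs => by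
    obtain ⟨s, rfl⟩ := ZMod.intCast_surjective s
    exact h (htype.2 ⟨s, (hsr_mem s).1 hs⟩)
  simp only [hperiod] at hr_mem
  -- Rotations in S have exponents in the intersection of 2ℤ and mℤ, that is, mℤ for even m and 2mℤ
  -- for odd m.
  have heven : Even m → ∀ k : ℤ, DihedralGroup.r (k : ZMod (2 * n)) ∈ S ↔ (m : ℤ) ∣ k :=
    fun h k => by
      rw [hr_mem]
      refine and_iff_right_of_imp fun hk => even_iff_two_dvd.2 (dvd_trans ?_ hk)
      exact_mod_cast h.two_dvd
  have hodd : Odd m → ∀ k : ℤ, DihedralGroup.r (k : ZMod (2 * n)) ∈ S ↔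
      ((2 * m : ℕ) : ℤ) ∣ k := fun h k => by
    rw [hr_mem, even_iff_two_dvd]
    have hcop : IsCoprime (2 : ℤ) (m : ℤ) := by
      rw [Int.isCoprime_iff_gcd_eq_one]
      exact_mod_cast (Nat.coprime_two_left.2 h)
    push_cast
    exact ⟨fun hk => hcop.mul_dvd hk.1 hk.2,
      fun hk => ⟨(dvd_mul_right _ _).trans hk, (dvd_mul_left _ _).trans hk⟩⟩
  -- The rotation subgroup of S thus has order 2r for even m and r for odd m.
  have he : 2 * n = m * (2 * r) := by rw [← hrm]; ring
  have ho : 2 * n = 2 * m * r := by rw [← hrm]; ring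
  refine ⟨fun hm1 ht => ?_, fun hm1 ht => ?_, fun hm1 ht => ?_, fun hm1 ht => ?_⟩
  · obtain ⟨s, hs⟩ := hsr1 ht
    obtain ⟨f⟩ := DihedralGroup.nonempty_mulEquiv_dihedral he hm0.ne' (heven hm1) hs
    refine ⟨?_, ?_, ?_⟩ <;> rintro rfl
    · exact DihedralGroup.nonempty_mulEquiv_two.map f.trans
    · exact ⟨f⟩
    · exact ⟨f⟩
  · have hS := DihedralGroup.eq_zpowers (heven hm1) (hsr2 ht)
    have hcyc := DihedralGroup.nonempty_mulEquiv_cyc he (by omega)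
    rw [← hS] at hcyc
    refine ⟨?_, ?_, ?_⟩ <;> rintro rfl
    · obtain rfl : m = n := by omega
      exact ⟨hS, hcyc⟩
    · rw [show n / 2 = m by omega]
      exact ⟨hS, hcyc⟩
    · rw [show n / 3 = m by omega]
      exact ⟨hS, hcyc⟩
  · obtain ⟨s, hs⟩ := hsr1 ht
    obtain ⟨f⟩ := DihedralGroup.nonempty_mulEquiv_dihedral ho (by omega) (hodd hm1) hs
    refine ⟨?_, ?_, ?_⟩ <;> rintro rfl
    · exact DihedralGroup.nonempty_mulEquiv_one.map f.trans
    · exact DihedralGroup.nonempty_mulEquiv_two.map f.trans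
    · exact ⟨f⟩
  · have hS := DihedralGroup.eq_zpowers (hodd hm1) (hsr2 ht)
    have hcyc := DihedralGroup.nonempty_mulEquiv_cyc ho (by omega)
    rw [← hS] at hcyc
    refine ⟨?_, ?_, ?_⟩ <;> rintro rfl
    · rw [hS, show 2 * m = 2 * n by omega, DihedralGroup.r_one_pow_n, Subgroup.zpowers_one_eq_bot]
    · obtain rfl : n = 2 * m := by omega
      exact ⟨hS, hcyc⟩
    · rw [show 2 * n / 3 = 2 * m by omega]
      exact ⟨hS, hcyc⟩
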